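/- **Setting.** Let $D$ be a probability distribution on $\mathcal X\times\{-1,+1\}$ with marginal $D_{\mathcal X}$ on $\mathcal X$, and let $\mathrm{err}(h)=\Pr_{(x,y)\sim D}[h(x)\ne y]$. Let $H_0\subseteq H_1\subseteq\cdots$ be a nested sequence of classes of measurable classifiers $\mathcal X\to\{-1,+1\}$; $H_k$ has finite VC dimension $d_k$ and is pointwise separable (it has a countable subclass containing, for every $h\in H_k$, a sequence that converges pointwise to $h$). Let $h^*$ be a classifier of smallest error rate in $\bigcup_k H_k$, let $k^*$ be the smallest index of a class that contains a classifier with this error rate, and let $h^*\in H_{k^*}$. Assume the realizable case $\mathrm{err}(h^*)=0$. For a class $V$ and a finite set $S$ of labeled examples put $V(S)=\{h\in V: h(x)=y \text{ for all }(x,y)\in S\}$ and $\mathrm{DIS}(V)=\{x:\exists h,h'\in V,\ h(x)\ne h'(x)\}$. The disagreement coefficient of $V$ at scale $r$ is $$\theta_V(r)=\sup_{h\in V,\ r'\ge r}\frac{\Pr_{D_{\mathcal X}}[\mathrm{DIS}(B_V(h,r'))]}{r'},\qquad B_V(h,r')=\{h'\in V:\Pr_{D_{\mathcal X}}[h'(x)\neq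 h(x)]\le r'\}.$$ **Oracles.** The learner draws unlabeled examples independently from $D_{\mathcal X}$; LABEL reveals the label, distributed according to $D$, of a drawn example. $\mathrm{SEARCH}(V)$ returns some labeled example $(x,h^*(x))$ with $h(x)\ne h^*(x)$ for all $h\in V$ if there is one, and $\bot$ otherwise; its choice is an arbitrary measurable function of the index of the current class and of the labeled examples that define the version space. **Subroutine $\mathrm{CAL}(V,\epsilon',\delta')$**, with a bound $d$ on the VC dimension of $V$. For $j=1,2,\dots$: draw $2^j$ unlabeled examples; query LABEL on those that lie in $\mathrm{DIS}(V(T))$, where $T$ is the set of examples labeled in the previous batches of this call; then add the new labeled examples to $T$. Return $T$ as soon as $\phi(d,2^j,\tfrac{\delta'}{2j(j+1)})\le\epsilon'$ or $V(T)=\emptyset$, where $\phi(d,m,\delta)=\frac1m\bigl(d\ln(em^2)+\ln\frac2\delta\bigr)$. **Algorithm**, with parameters $\epsilon,\delta\in(0,1)$. Start with $S=\emptyset$, $k=0$, $\ell=0$. In for-loop iteration $i=1,2,\dots$: query $\mathrm{SEARCH}(H_k(S))$. If the answer is $\bot$, then halt and return any $h\in H_k(S)$ if $2^{-\ell}\le\epsilon$,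 and otherwise increase $\ell$ by one. If the answer is a counterexample $e$, add $e$ to $S$ and set $k=\min\{k':H_{k'}(S)\ne\emptyset\}$. Then add to $S$ the result of $\mathrm{CAL}(H_k(S),2^{-\ell},\delta/(i^2+i))$, called with $d=d_k$. **Theorem.** There are universal constants $C,c$ such that the following holds in the above setting for all $\epsilon,\delta\in(0,1)$. For $k'\le k^*$ let $\theta_{k'}$ be the disagreement coefficient of $H_{k'}(S_{[k']})$, where $S_{[k']}$ is the set $S$ at the first time that $k\ge k'$ (indices that are never reached are left out of the maximum below). Put $L=\max\{1,\ln(1/\epsilon)\}$ and $\theta=\max\{1,\max_{k'\le k^*}\theta_{k'}(\epsilon)\}$. With probability at least $1-\delta$, the algorithm * halts in for-loop iteration $k^*+\lceil\log_2(1/\epsilon)\rceil+1$ or earlier; * has a nonempty version space $H_k(S)$ when it halts, and whichever classifier in it is returned has error rate at most $\epsilon$; * draws at most $$C\cdot\frac{\max\{1,k^*\}\max\{1,d_{k^*}\}}{\epsilon}\cdot\Bigl(1+\ln\frac{\max\{1,k^*\}\max\{1,d_{k^*}\}}{\epsilon\delta}\Bigr)^{c}$$ unlabeled examples, that is, $\tilde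 O(k^*d_{k^*}/\epsilon)$; * makes at most $k^*+\lceil\log_2(1/\epsilon)\rceil+1$ queries to SEARCH; * makes at most $$C\cdot(k^*+L)\cdot\theta\cdot d_{k^*}\cdot L^2\cdot\Bigl(1+\ln\frac{(k^*+L)\max\{1,d_{k^*}\}}{\delta}\Bigr)^{c}$$ queries to LABEL, that is, $\tilde O\bigl((k^*+\log(1/\epsilon))\cdot\max_{k'\le k^*}\theta_{k'}(\epsilon)\cdot d_{k^*}\cdot\log^2(1/\epsilon)\bigr)$. -/

import Mathlib

open MeasureTheory Set Filter

namespace ActiveLearning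

variable {X : Type*}

/-! ## Hypothesis classes

Labels are Booleans (`true` stands for `+1`, `false` for `-1`), a hypothesis is a function
`X → Bool`, and a finite set of labeled examples is presented as a list in order of
acquisition. -/

/-- `H(S)`: the hypotheses in `V` that are consistent with all the labeled examples in `S`. -/
def versionSpace (V : Set (X → Bool)) (S : List (X × Bool)) : Set (X → Bool) :=
  {h ∈ V | ∀ p ∈ S, h p.1 = p.2}

/-- The region of disagreement of a set of hypotheses. -/
def disagreement (V : Set (X → Bool)) : Set X :=
  {x | ∃ h ∈ V, ∃ h' ∈ V, h x ≠ h' x}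

/-- `V` shatters the finite set `s`: every labeling of `s` is realized in `V`. -/
def Shatters (V : Set (X → Bool)) (s : Finset X) : Prop :=
  ∀ f : X → Bool, ∃ h ∈ V, ∀ x ∈ s, h x = f x

/-- The VC dimension: the supremum of the cardinalities of the shattered finite sets. -/
noncomputable def vcDim (V : Set (X → Bool)) : ℕ∞ :=
  ⨆ (s : Finset X) (_ : Shatters V s), (s.card : ℕ∞)

/-- Pointwise separability, the usual regularity condition under which suprema over a class are
measurable: some countable subclass contains, for every `h ∈ V`, a sequence converging
pointwise to `h`. -/
def PointwiseSeparable (V : Set (X → Bool)) : Prop :=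
  ∃ V₀ ⊆ V, V₀.Countable ∧ ∀ h ∈ V, ∃ g : ℕ → X → Bool,
    (∀ n, g n ∈ V₀) ∧ ∀ x, ∀ᶠ n in atTop, g n x = h x

section Distribution

variable [MeasurableSpace X]

/-- The error rate of `h` under the distribution `D` on labeled examples. -/
noncomputable def err (D : Measure (X × Bool)) (h : X → Bool) : ℝ :=
  D.real {p | h p.1 ≠ p.2}

/-- `hstar` is an optimal hypothesis of the whole sequence `H`, and `kstar` is the smallest
index of a class that contains a hypothesis with this minimal error rate. -/
def IsOptimal (D : Measure (X × Bool)) (H : ℕ → Set (X → Bool)) (kstar : ℕ)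
    (hstar : X → Bool) : Prop :=
  hstar ∈ H kstar ∧ (∀ k, ∀ h ∈ H k, err D hstar ≤ err D h) ∧
    ∀ k < kstar, ∀ h ∈ H k, err D hstar < err D h

/-- The ball of radius `r` around `h` in `V`, for the disagreement pseudometric of the
distribution `P` on instances. -/
def hypothesisBall (P : Measure X) (V : Set (X → Bool)) (h : X → Bool) (r : ℝ) :
    Set (X → Bool) :=
  {h' ∈ V | P.real {x | h' x ≠ h x} ≤ r}

/-- The disagreement coefficient of `V` at scale `r`,
`sup_{h ∈ V, r' ≥ r} P (DIS (B_V (h, r'))) / r'`. -/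
noncomputable def disagreementCoeff (P : Measure X) (V : Set (X → Bool)) (r : ℝ) : ENNReal :=
  ⨆ (h ∈ V) (r' : ℝ) (_ : r ≤ r'),
    P (disagreement (hypothesisBall P V h r')) / ENNReal.ofReal r'

end Distribution

/-! ## The SEARCH oracle -/

/-- `search k S` is the answer of the oracle to the query `SEARCH_{H_k}(H_k(S))`; it may depend
on `S` and not only on the version space. The oracle returns a counterexample `(x, hstar x)`,
misclassified by every member of the version space, whenever there is one, and `none`
otherwise. -/
def IsSearchOracle (H : ℕ → Set (X → Bool)) (hstar : X → Bool)
    (search : ℕ → List (X × Bool) → Option (X × Bool)) : Prop :=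
  ∀ k S,
    (∀ e, search k S = some e →
      e.2 = hstar e.1 ∧ ∀ h ∈ versionSpace (H k) S, h e.1 ≠ hstar e.1) ∧
    (search k S = none → ¬ ∃ x, ∀ h ∈ versionSpace (H k) S, h x ≠ hstar x)

/-- The answers of the oracle are measurable functions of the examples in the query. -/
def MeasurableOracle [MeasurableSpace X]
    (search : ℕ → List (X × Bool) → Option (X × Bool)) : Prop :=
  ∀ (k n : ℕ) (A : Set (X × Bool)), MeasurableSet A →
    MeasurableSet {v : Fin n → X × Bool | ∃ e ∈ A, search k (List.ofFn v) = some e}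

/-! ## The algorithm -/

/-- The deviation term `φ(d, m, δ) = (d log (e m²) + log (2 / δ)) / m`. -/
noncomputable def phi (d m : ℕ) (δ : ℝ) : ℝ :=
  (d * Real.log (Real.exp 1 * (m : ℝ) ^ 2) + Real.log (2 / δ)) / m

/-- The control state of the algorithm: about to start a for-loop iteration (with its SEARCH
call), about to execute batch `j` of a run of CAL which has collected the labeled examples `T`
in its earlier batches, or halted. -/
inductive Phase (X : Type*)
  | search
  | cal (j : ℕ) (T : List (X × Bool))
  | halted

/-- A configuration of the algorithm: the labeled examples `S`, the indices `k` and `l`, the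
number `iter` of the current for-loop iteration, the control state, and the numbers of
unlabeled examples drawn, of LABEL queries and of SEARCH queries made so far. -/
structure Config (X : Type*) where
  S : List (X × Bool)
  k : ℕ
  l : ℕ
  iter : ℕ
  phase : Phase X
  draws : ℕ
  labels : ℕ
  searches : ℕ

/-- The initial configuration. -/
def initConfig (X : Type*) : Config X where
  S := []
  k := 0
  l := 0
  iter := 1
  phase := Phase.search
  draws := 0
  labels := 0
  searches := 0

open Classical in
/-- The first part of a for-loop iteration: one SEARCH query and the processing of its answer.
Unless the algorithm halts, CAL is called next. -/
noncomputable def searchStep (H : ℕ → Set (X → Bool))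
    (search : ℕ → List (X × Bool) → Option (X × Bool)) (ε : ℝ) (s : Config X) : Config X :=
  match search s.k s.S with
  | none =>
      if (2 : ℝ)⁻¹ ^ s.l ≤ ε then
        { s with phase := Phase.halted, searches := s.searches + 1 }
      else
        { s with l := s.l + 1, phase := Phase.cal 1 [], searches := s.searches + 1 }
  | some e =>
      { s with
        S := s.S ++ [e]
        k := sInf {k' | (versionSpace (H k') (s.S ++ [e])).Nonempty}
        phase := Phase.cal 1 []
        searches := s.searches + 1 }

/-- The labeled examples of batch `j` of the CAL run in for-loop iteration `i`. The family `ω`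
consists of independent draws from `D`; the label of a draw is used only if LABEL is queried. -/
def batch (ω : ℕ × ℕ × ℕ → X × Bool) (i j : ℕ) : List (X × Bool) :=
  (List.range (2 ^ j)).map fun p => ω (i, j, p)

open Classical in
/-- Batch `j` of the run `CAL(H_k(S), LABEL, 2^{-l}, δ / (i² + i))` in for-loop iteration `i`:
`2 ^ j` examples are drawn, LABEL is queried on those in the region of disagreement of the
version space left by the previous batches, and the run stops if the deviation term is small
enough or the version space is empty. -/
noncomputable def calStep (H : ℕ → Set (X → Bool)) (d : ℕ → ℕ) (δ : ℝ)
    (ω : ℕ × ℕ × ℕ → X × Bool) (s : Config X) (j : ℕ) (T : List (X × Bool)) : Config X :=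
  let V := versionSpace (H s.k) s.S
  let Tj := (batch ω s.iter j).filter fun p => decide (p.1 ∈ disagreement (versionSpace V T))
  let δcal := δ / ((s.iter : ℝ) ^ 2 + s.iter)
  let δj := δcal / ((j : ℝ) * (j + 1))
  let draws := s.draws + 2 ^ j
  let labels := s.labels + Tj.length
  if phi (d s.k) (2 ^ j) (δj / 2) ≤ (2 : ℝ)⁻¹ ^ s.l ∨ versionSpace V (T ++ Tj) = ∅ then
    { s with
      S := s.S ++ (T ++ Tj)
      iter := s.iter + 1
      phase := Phase.search
      draws := draws
      labels := labels }
  else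
    { s with phase := Phase.cal (j + 1) (T ++ Tj), draws := draws, labels := labels }

/-- One step of the algorithm. -/
noncomputable def step (H : ℕ → Set (X → Bool)) (d : ℕ → ℕ)
    (search : ℕ → List (X × Bool) → Option (X × Bool)) (ε δ : ℝ)
    (ω : ℕ × ℕ × ℕ → X × Bool) (s : Config X) : Config X :=
  match s.phase with
  | Phase.search => searchStep H search ε s
  | Phase.cal j T => calStep H d δ ω s j T
  | Phase.halted => s

/-- The configuration after `t` steps. -/
noncomputable def run (H : ℕ → Set (X → Bool)) (d : ℕ → ℕ)
    (search : ℕ → List (X × Bool) → Option (X × Bool)) (ε δ : ℝ)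
    (ω : ℕ × ℕ × ℕ → X × Bool) : ℕ → Config X
  | 0 => initConfig X
  | t + 1 => step H d search ε δ ω (run H d search ε δ ω t)

/-- `max_{k' ≤ kstar} θ_{k'}(r)` along a run `ρ`, where `θ_{k'}` is the disagreement coefficient
of `H_{k'}(S)` for the examples `S` held at the first time `t` at which `k' ≤ k`. An index `k'`
that the run never reaches does not contribute. -/
noncomputable def maxDisagreementCoeff [MeasurableSpace X] (P : Measure X)
    (H : ℕ → Set (X → Bool)) (ρ : ℕ → Config X) (kstar : ℕ) (r : ℝ) : ENNReal :=
  ⨆ (k' : ℕ) (_ : k' ≤ kstar) (t : ℕ) (_ : IsLeast {t | k' ≤ (ρ t).k} t),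
    disagreementCoeff P (versionSpace (H k') (ρ t).S) r

end ActiveLearning

open ActiveLearning

/-! The proof separates probability from combinatorics. All draws form one product family indexed by
(iteration, batch, position). `GoodSample` is the event that every label agrees with `hstar` and
that each batch actually executed satisfies three deviation bounds (`GoodBatch`): a hypothesis
agreeing with `hstar` on the batch has small error, two hypotheses agreeing on the batch are close,
and the number of queries is at most about twice its mean. Batch (i, j) fails with probability at
most `batchDelta δ i j`, and these numbers sum to at most δ (`infinitePi_not_goodSample_le`). The
first two bounds come from `missed_event_bound`, a symmetrization with a ghost sample of size m²,
which loses only a constant and hence fits the deviation term `phi`. Batches are chosen adaptively,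
but a batch is executed at most once and its draws are unread until then, so they can be resampled
with everything else frozen (`infinitePi_atBatch_le`). Separability reduces all suprema and
measurability questions to countable subclasses.

On a good sample the rest is deterministic (`RunInvariant`). A counterexample empties the current
version space and so raises k, which stays at most `kstar` because `hstar` is consistent with S; the
answer ⊥ raises l or halts. This bounds the iterations. The version space need not contain `hstar`
while k < `kstar`; correctness comes from ⊥ itself: every point is classified like `hstar` by some
member. In the last batch of the preceding CAL call, queried points carry the labels of `hstar`, and
on the other points all members agree, hence agree with `hstar`. So each member is correct on the
whole batch and has error at most 2^{-l}.

For the labels: after an unfinished batch all surviving hypotheses agree on it, so the version space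
has diameter at most 2φ, and 2φ ≥ ε since CAL did not stop. The disagreement coefficient bounds the
next region of disagreement by 2θφ. Doubling the batch size cancels the factor 1/m in φ, so each
batch costs O(θ(d·J + log)) labels, with J = O(log) batches per call (`labelBound_of_batch_bound`,
`exists_batch_bound`). -/

namespace ActiveLearning

/-! ### Resampling some coordinates of a product measure. -/

section ProductMeasure

open Classical in
/-- The family that agrees with `v` on `I` and with `u` elsewhere. -/
noncomputable def merge {ι Z : Type*} (I : Set ι) (u v : ι → Z) : ι → Z :=
  fun i => if i ∈ I then v i else u i

theorem measurePreserving_merge {ι Z : Type*} [MeasurableSpace Z] (P : Measure Z)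
    [IsProbabilityMeasure P] (I : Set ι) :
    MeasurePreserving (fun q : (ι → Z) × (ι → Z) => merge I q.1 q.2)
      ((Measure.infinitePi fun _ => P).prod (Measure.infinitePi fun _ => P))
      (Measure.infinitePi fun _ => P) := by
  classical
  have hm : Measurable (fun q : (ι → Z) × (ι → Z) => merge I q.1 q.2) := by
    refine measurable_pi_lambda _ fun i => ?_
    by_cases hi : i ∈ I
    · simp only [merge, hi, if_true]; fun_prop
    · simp only [merge, hi, if_false]; fun_prop
  refine ⟨hm, Measure.eq_infinitePi _ fun s t ht => ?_⟩
  rw [Measure.map_apply hm (MeasurableSet.pi s.countable_toSet fun i _ => ht i)]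
  have : (fun q : (ι → Z) × (ι → Z) => merge I q.1 q.2) ⁻¹' (Set.pi s t) =
      (Set.pi (s.filter fun i => ¬ i ∈ I : Finset ι) t) ×ˢ
        (Set.pi (s.filter fun i => i ∈ I : Finset ι) t) := by
    ext q
    simp only [mem_preimage, Set.mem_pi, merge, Finset.mem_coe, mem_prod, Finset.mem_filter]
    constructor
    · intro h
      refine ⟨fun i hi => ?_, fun i hi => ?_⟩
      · simpa [hi.2] using h i hi.1
      · simpa [hi.2] using h i hi.1
    · rintro ⟨h1, h2⟩ i hi
      by_cases hI : i ∈ I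
      · simpa [hI] using h2 i ⟨hi, hI⟩
      · simpa [hI] using h1 i ⟨hi, hI⟩
  rw [this, Measure.prod_prod, Measure.infinitePi_pi _ fun i _ => ht i,
    Measure.infinitePi_pi _ fun i _ => ht i, mul_comm]
  exact Finset.prod_filter_mul_prod_filter_not s (fun i => i ∈ I) fun i => P (t i)

/-- Fubini: replacing the coordinates in `I` by fresh ones preserves the law, so a bound that holds
for every frozen value of the other coordinates holds unconditionally. -/
theorem infinitePi_le_of_merge_le {ι Z : Type*} [MeasurableSpace Z] (P : Measure Z)
    [IsProbabilityMeasure P] (I : Set ι) {E : Set (ι → Z)} (hE : MeasurableSet E) {δ : ENNReal}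
    (h : ∀ u, (Measure.infinitePi fun _ : ι => P) {v | merge I u v ∈ E} ≤ δ) :
    (Measure.infinitePi fun _ : ι => P) E ≤ δ := by
  have hp := measurePreserving_merge P I
  rw [← hp.measure_preimage hE.nullMeasurableSet, Measure.prod_apply (hp.measurable hE)]
  calc _ ≤ ∫⁻ _, δ ∂(Measure.infinitePi fun _ : ι => P) := lintegral_mono fun u => h u
    _ = δ := by simp

theorem lintegral_infinitePi_prod {ι Z : Type*} [Fintype ι] [MeasurableSpace Z] (P : Measure Z)
    [IsProbabilityMeasure P] (f : ι → Z → ENNReal) (hf : ∀ i, Measurable (f i)) :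
    ∫⁻ v, ∏ i, f i (v i) ∂(Measure.infinitePi fun _ : ι => P) = ∏ i, ∫⁻ z, f i z ∂P := by
  have h := ProbabilityTheory.iIndepFun_infinitePi (P := fun _ : ι => P) hf
  rw [ProbabilityTheory.lintegral_prod_eq_prod_lintegral_of_indepFun Finset.univ _ h
    (fun i => (hf i).comp (measurable_pi_apply i))]
  refine Finset.prod_congr rfl fun i _ => ?_
  rw [← Measure.infinitePi_map_eval (fun _ : ι => P) i,
    lintegral_map (hf i) (measurable_pi_apply i), Measure.infinitePi_map_eval]

end ProductMeasure

/-! ### Symmetrization with a ghost sample of quadratic size. -/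

section Symmetrization

/-- Bernoulli's inequality for 1 - 1/(m+1), which is the inverse of 1 + 1/m, together with l/(m+1) =
1 - k/(m+1). Here k counts the marked and l the unmarked points of one group. -/
theorem mul_pow_le_of_add_eq {m k l : ℕ} (hm : 0 < m) (h : l + k = m + 1) :
    (l : ENNReal) * ENNReal.ofReal (1 + 1 / m) ^ k ≤ (m : ENNReal) + 1 := by
  have hm' : (0 : ℝ) < m := by exact_mod_cast hm
  have hB : 1 + (k : ℝ) * (-1 / (m + 1)) ≤ (1 + (-1 / (m + 1))) ^ k := by
    apply one_add_mul_le_pow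
    rw [le_div_iff₀ (by positivity)]; linarith
  have e1 : (1 + (-1 / ((m : ℝ) + 1))) = (1 + 1 / (m : ℝ))⁻¹ := by field_simp; ring
  have e2 : 1 + (k : ℝ) * (-1 / (m + 1)) = l / (m + 1) := by
    have : (l : ℝ) = m + 1 - k := by
      have : (l : ℝ) + k = m + 1 := by exact_mod_cast h
      linarith
    rw [this]; field_simp; ring
  rw [e1, e2, inv_pow, div_le_iff₀ (by positivity), ← div_eq_inv_mul,
    le_div_iff₀ (by positivity)] at hB
  have h1 : (l : ENNReal) = ENNReal.ofReal l := by simp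
  have h2 : (m : ENNReal) + 1 = ENNReal.ofReal (m + 1) := by
    rw [ENNReal.ofReal_add (by positivity) (by positivity)]; simp
  rw [h1, h2, ← ENNReal.ofReal_pow (by positivity), ← ENNReal.ofReal_mul (by positivity)]
  exact ENNReal.ofReal_le_ofReal hB

/-- The weighted number of ways of selecting one unmarked point in each of `m` groups of
`m + 1` points. -/
theorem sum_selections_le {m : ℕ} (hm : 0 < m) (c : Fin m × Fin (m + 1) → Bool) :
    ∑ s : Fin m → Fin (m + 1), (if ∀ g, c (g, s g) = false then
      ∏ i, (if c i = true then ENNReal.ofReal (1 + 1 / m) else 1) else 0)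
      ≤ ((m : ENNReal) + 1) ^ m := by
  set w := ENNReal.ofReal (1 + 1 / m)
  have h1 : ∀ s : Fin m → Fin (m + 1), (if ∀ g, c (g, s g) = false then
      ∏ i, (if c i = true then w else 1) else 0) =
      (∏ g, if c (g, s g) = false then (1 : ENNReal) else 0) *
        ∏ i, (if c i = true then w else 1) := by
    intro s
    split_ifs with h
    · simp [h]
    · push Not at h
      obtain ⟨g, hg⟩ := h
      rw [Finset.prod_eq_zero (Finset.mem_univ g), zero_mul]
      simp [hg]
  simp_rw [h1]
  -- Indicator and weight both factor over the groups, so the sum over selections is a product of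
  -- one-group sums: unmarked points times w to the number of marked points.
  rw [← Finset.sum_mul, ← Fintype.prod_sum
    (fun g b => if c (g, b) = false then (1 : ENNReal) else 0), Fintype.prod_prod_type,
    ← Finset.prod_mul_distrib]
  calc _ ≤ ∏ _g : Fin m, ((m : ENNReal) + 1) := by
        refine Finset.prod_le_prod' fun g _ => ?_
        rw [Finset.sum_boole, Finset.prod_ite]
        simp only [Finset.prod_const, one_pow, mul_one]
        refine mul_pow_le_of_add_eq hm ?_
        have := Finset.card_filter_add_card_filter_not (s := (Finset.univ : Finset (Fin (m + 1))))
          (fun b => c (g, b) = false)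
        simpa using this
    _ = _ := by simp

variable {Z : Type*} [MeasurableSpace Z]

/-- A deviation inequality for a countable class of events, by symmetrization with a ghost
sample of size `m ^ 2`: the probability that an event of probability more than `φ` is missed by
`m` independent points. -/
theorem missed_event_bound (P : Measure Z) [IsProbabilityMeasure P] (𝒜 : Set (Z → Bool))
    (hc : 𝒜.Countable) (hmeas : ∀ a ∈ 𝒜, Measurable a) {m : ℕ} (hm : 0 < m) (Γ : ℕ)
    (hΓ : ∀ x : Fin m × Fin (m + 1) → Z,
      {c : Fin m × Fin (m + 1) → Bool | ∃ a ∈ 𝒜, c = a ∘ x}.ncard ≤ Γ)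
    {φ : ℝ} (hφ : 0 ≤ φ) :
    (Measure.infinitePi fun _ : Fin m => P)
      {u | ∃ a ∈ 𝒜, φ < P.real {z | a z = true} ∧ ∀ g, a (u g) = false} *
      ENNReal.ofReal (1 + φ / m) ^ (m * m) ≤ Γ := by
  classical
  have hm' : (0 : ℝ) < m := by exact_mod_cast hm
  set w := ENNReal.ofReal (1 + 1 / m)
  set μ := Measure.infinitePi fun _ : Fin m × Fin (m + 1) => P
  set B := {u : Fin m → Z | ∃ a ∈ 𝒜, φ < P.real {z | a z = true} ∧ ∀ g, a (u g) = false}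
  have hset : ∀ a ∈ 𝒜, ∀ b : Bool, MeasurableSet {z | a z = b} := fun a ha b =>
    hmeas a ha (measurableSet_singleton b)
  have hB : MeasurableSet B := by
    have : B = ⋃ a ∈ 𝒜, {_u | φ < P.real {z | a z = true}} ∩ ⋂ g, {u | a (u g) = false} := by
      ext u
      simp only [B, Set.mem_ofPred_eq, Set.mem_iUnion, Set.mem_inter_iff, Set.mem_iInter,
        exists_prop]
    rw [this]
    refine MeasurableSet.biUnion hc fun a ha => (MeasurableSet.const _).inter ?_
    exact MeasurableSet.iInter fun g => (measurable_pi_apply (X := fun _ => Z) g) (hset a ha false)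
  -- `s` selects the true sample, one point per group; the other m² points are the ghost sample. A
  -- pattern vanishing on the true sample gets weight w to the number of marked points. Summing over
  -- patterns rather than over `𝒜` makes `Γ` the only cost of uniformity.
  let W (s : Fin m → Fin (m + 1)) (x : Fin m × Fin (m + 1) → Z) : ENNReal :=
    ∑ c : Fin m × Fin (m + 1) → Bool, if (∃ a ∈ 𝒜, c = a ∘ x) then
      (if ∀ g, c (g, s g) = false then ∏ i, (if c i = true then w else 1) else 0) else 0
  have hW : ∀ s, Measurable (W s) := by
    intro s
    refine Finset.measurable_sum _ fun c _ => Measurable.ite ?_ measurable_const measurable_const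
    have : {x : Fin m × Fin (m + 1) → Z | ∃ a ∈ 𝒜, c = a ∘ x} =
        ⋃ a ∈ 𝒜, ⋂ i, {x | a (x i) = c i} := by
      ext x; simp [funext_iff, eq_comm]
    rw [this]
    exact MeasurableSet.biUnion hc fun a ha => MeasurableSet.iInter fun i =>
      (measurable_pi_apply (X := fun _ => Z) i) (hset a ha (c i))
  have hup : ∀ x, ∑ s, W s x ≤ Γ * ((m : ENNReal) + 1) ^ m := by
    intro x
    rw [Finset.sum_comm]
    calc _ ≤ ∑ c : Fin m × Fin (m + 1) → Bool,
          (if ∃ a ∈ 𝒜, c = a ∘ x then ((m : ENNReal) + 1) ^ m else 0) := by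
          refine Finset.sum_le_sum fun c _ => ?_
          split_ifs with h
          · exact sum_selections_le hm c
          · simp
      _ ≤ _ := by
          rw [← Finset.sum_filter, Finset.sum_const, nsmul_eq_mul]
          gcongr
          refine le_trans (le_of_eq ?_) (hΓ x)
          rw [← Set.ncard_coe_finset]; simp
  have hlow : ∀ s, (Measure.infinitePi fun _ : Fin m => P) B *
      ENNReal.ofReal (1 + φ / m) ^ (m * m) ≤ ∫⁻ x, W s x ∂μ := by
    intro s
    set I : Set (Fin m × Fin (m + 1)) := {i | ¬ i.2 = s i.1} with hI
    have hsel : Measurable fun (x : Fin m × Fin (m + 1) → Z) (g : Fin m) => x (g, s g) := by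
      fun_prop
    have hBs : (Measure.infinitePi fun _ : Fin m => P) B =
        μ ((fun (x : Fin m × Fin (m + 1) → Z) (g : Fin m) => x (g, s g)) ⁻¹' B) := by
      have hinj : Function.Injective fun g : Fin m => (g, s g) := fun a b h =>
        congrArg Prod.fst h
      rw [← Measure.map_infinitePi_infinitePi_of_inj
        (P := fun _ : Fin m × Fin (m + 1) => P) hinj, Measure.map_apply hsel hB]
    have hp := measurePreserving_merge P I
    have hint : ∫⁻ x, W s x ∂μ = ∫⁻ u, ∫⁻ v, W s (merge I u v) ∂μ ∂μ := by
      rw [← hp.lintegral_comp (hW s)]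
      exact lintegral_prod _ ((hW s).comp hp.measurable).aemeasurable
    rw [hint, hBs, mul_comm, ← lintegral_indicator_const (hsel hB)]
    refine lintegral_mono fun u => ?_
    by_cases hu : u ∈ (fun (x : Fin m × Fin (m + 1) → Z) (g : Fin m) => x (g, s g)) ⁻¹' B
    swap
    · simp [Set.indicator_of_notMem hu]
    rw [Set.indicator_of_mem hu]
    -- The witness `a` depends only on the selected points, which `u` freezes. The m² ghost points
    -- in `v` are fresh, and each contributes a factor of mean 1 + P(a)/m ≥ 1 + φ/m.
    obtain ⟨a, ha, hPa, hag⟩ := hu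
    let f (i : Fin m × Fin (m + 1)) (z : Z) : ENNReal :=
      if i ∈ I then (1 + {z | a z = true}.indicator (fun _ => ENNReal.ofReal (1 / m)) z) else 1
    have hf : ∀ i, Measurable (f i) := by
      intro i
      by_cases hi : i ∈ I
      · simp only [f, hi, if_true]
        exact (measurable_const.indicator (hset a ha true)).const_add 1
      · simp only [f, hi, if_false]; exact measurable_const
    have hw : w = 1 + ENNReal.ofReal (1 / m) := by
      simp only [w]
      rw [ENNReal.ofReal_add zero_le_one (by positivity), ENNReal.ofReal_one]
    have hge : ∀ v, ∏ i, f i (v i) ≤ W s (merge I u v) := by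
      intro v
      have hsel0 : ∀ g, (a ∘ merge I u v) (g, s g) = false := by
        intro g
        simpa [merge, hI] using hag g
      refine le_trans (le_of_eq ?_) (Finset.single_le_sum (fun c _ => zero_le)
        (Finset.mem_univ (a ∘ merge I u v)))
      rw [if_pos ⟨a, ha, rfl⟩, if_pos hsel0]
      refine Finset.prod_congr rfl fun i _ => ?_
      by_cases hi : i ∈ I
      · by_cases hav : a (v i) = true
        · simp [f, hi, merge, hav, hw]
        · simp [f, hi, merge, hav]
      · have hi' : i = (i.1, s i.1) := by
          have : i.2 = s i.1 := by simpa [hI] using hi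
          rw [← this]
        have : (a ∘ merge I u v) i = false := by rw [hi']; exact hsel0 _
        simp only [f, hi, if_false, this]
        simp
    have hcard : (Finset.univ.filter fun i => i ∈ I).card = m * m := by
      have h1 := Finset.card_filter_add_card_filter_not
        (s := (Finset.univ : Finset (Fin m × Fin (m + 1)))) (fun i => i.2 = s i.1)
      have h2 : (Finset.univ.filter fun i : Fin m × Fin (m + 1) => i.2 = s i.1).card = m := by
        have : (Finset.univ.filter fun i : Fin m × Fin (m + 1) => i.2 = s i.1) =
            Finset.univ.image fun g => (g, s g) := by
          ext ⟨g, b⟩; simp [eq_comm]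
        rw [this, Finset.card_image_of_injective _ fun a b h => congrArg Prod.fst h]
        simp
      simp only [hI, Set.mem_ofPred_eq]
      simp only [Finset.card_univ, Fintype.card_prod, Fintype.card_fin] at h1
      nlinarith
    calc _ ≤ ∏ i, (if i ∈ I then ENNReal.ofReal (1 + φ / m) else 1) := by
          rw [Finset.prod_ite, Finset.prod_const, Finset.prod_const_one, mul_one, hcard]
      _ ≤ ∏ i, ∫⁻ z, f i z ∂P := by
          refine Finset.prod_le_prod' fun i _ => ?_
          by_cases hi : i ∈ I
          · simp only [f, hi, if_true]
            rw [lintegral_add_left measurable_const,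
              lintegral_indicator_const (hset a ha true), lintegral_const, measure_univ, mul_one,
              ENNReal.ofReal_add zero_le_one (by positivity), ENNReal.ofReal_one,
              ← ENNReal.ofReal_toReal (measure_ne_top P {z | a z = true}),
              ← ENNReal.ofReal_mul (by positivity)]
            gcongr
            rw [div_eq_inv_mul, one_div]
            exact mul_le_mul_of_nonneg_left hPa.le (by positivity)
          · simp [f, hi]
      _ = ∫⁻ v, ∏ i, f i (v i) ∂μ := (lintegral_infinitePi_prod P f hf).symm
      _ ≤ _ := lintegral_mono hge
  have hfin : ((m : ENNReal) + 1) ^ m ≠ ⊤ := by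
    exact ENNReal.pow_ne_top (by simp)
  have hne : ((m : ENNReal) + 1) ^ m ≠ 0 := pow_ne_zero _ (by simp)
  -- The lower bound is the same for each of the (m+1)^m selections, and the upper bound controls
  -- their sum, so the factor (m+1)^m cancels.
  have key : ((m : ENNReal) + 1) ^ m * ((Measure.infinitePi fun _ : Fin m => P) B *
      ENNReal.ofReal (1 + φ / m) ^ (m * m)) ≤ ((m : ENNReal) + 1) ^ m * Γ := by
    calc _ = ∑ _s : Fin m → Fin (m + 1), (Measure.infinitePi fun _ : Fin m => P) B *
          ENNReal.ofReal (1 + φ / m) ^ (m * m) := by simp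
      _ ≤ ∑ s, ∫⁻ x, W s x ∂μ := Finset.sum_le_sum fun s _ => hlow s
      _ = ∫⁻ x, ∑ s, W s x ∂μ := (lintegral_finsetSum _ fun s _ => hW s).symm
      _ ≤ ∫⁻ _x, Γ * ((m : ENNReal) + 1) ^ m ∂μ := lintegral_mono hup
      _ = _ := by simp [mul_comm]
  exact (ENNReal.mul_le_mul_iff_right hne hfin).1 key

end Symmetrization

/-! ### Sauer–Shelah bounds for patterns, errors and differences. -/

section Growth

/-- Termwise comparison with the binomial expansion: C(N, k) ≤ N^k ≤ N^k C(d, k). -/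
theorem sum_Iic_choose_le (N d : ℕ) : ∑ k ∈ Finset.Iic d, N.choose k ≤ (N + 1) ^ d := by
  rw [add_pow]
  have : Finset.Iic d = Finset.range (d + 1) := by ext; simp
  rw [this]
  refine Finset.sum_le_sum fun k hk => ?_
  have hk' : k ≤ d := Nat.lt_succ_iff.1 (Finset.mem_range.1 hk)
  calc N.choose k ≤ N ^ k := Nat.choose_le_pow N k
    _ ≤ N ^ k * 1 ^ (d - k) * d.choose k := by
      rw [one_pow, mul_one]
      exact Nat.le_mul_of_pos_right _ (Nat.choose_pos hk')

/-- The Sauer-Shelah bound on the number of patterns that a class cuts out of a sample. -/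
theorem ncard_patterns_le {X ι : Type*} [Fintype ι] {V : Set (X → Bool)} {d : ℕ}
    (hV : vcDim V ≤ d) (x : ι → X) :
    {c : ι → Bool | ∃ h ∈ V, c = h ∘ x}.ncard ≤ (Fintype.card ι + 1) ^ d := by
  classical
  set 𝒜 : Finset (Finset ι) :=
    Finset.univ.filter fun t => ∃ h ∈ V, ∀ i, i ∈ t ↔ h (x i) = true with h𝒜
  have h1 : {c : ι → Bool | ∃ h ∈ V, c = h ∘ x}.ncard ≤ 𝒜.card := by
    rw [← Set.ncard_coe_finset]
    refine Set.ncard_le_ncard_of_injOn (fun c => Finset.univ.filter fun i => c i = true) ?_ ?_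
      (Finset.finite_toSet _)
    · rintro c ⟨h, hh, rfl⟩
      simp only [h𝒜, Finset.coe_filter, Finset.mem_univ, true_and, Set.mem_ofPred_eq]
      exact ⟨h, hh, fun i => by simp⟩
    · intro c _ c' _ hcc
      funext i
      have := Finset.ext_iff.1 hcc i
      simp only [Finset.mem_filter, Finset.mem_univ, true_and] at this
      exact Bool.eq_iff_iff.2 this
  have h2 : 𝒜.vcDim ≤ d := by
    refine Finset.sup_le fun s hs => ?_
    rw [Finset.mem_shatterer] at hs
    -- Sample points may repeat, but a shattered index set cannot hold two indices of the same
    -- point: a singleton must be cut out of it.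
    have hinj : Set.InjOn x s := by
      intro a ha b hb hab
      obtain ⟨t, ht, hst⟩ := hs (t := {a}) (by simpa using ha)
      obtain ⟨h, _, hh⟩ := (Finset.mem_filter.1 ht).2
      have hat : a ∈ t := by
        have : a ∈ s ∩ t := by rw [hst]; simp
        exact (Finset.mem_inter.1 this).2
      have hbt : b ∈ t := (hh b).2 (hab ▸ (hh a).1 hat)
      have : b ∈ s ∩ t := Finset.mem_inter.2 ⟨hb, hbt⟩
      rw [hst] at this
      exact (Finset.mem_singleton.1 this).symm
    have hsh : Shatters V (s.image x) := by
      intro f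
      obtain ⟨t, ht, hst⟩ := hs (t := s.filter fun i => f (x i) = true) (Finset.filter_subset _ _)
      obtain ⟨h, hhV, hh⟩ := (Finset.mem_filter.1 ht).2
      refine ⟨h, hhV, ?_⟩
      simp only [Finset.forall_mem_image]
      intro i hi
      have := Finset.ext_iff.1 hst i
      simp only [Finset.mem_inter, Finset.mem_filter, hi, true_and] at this
      exact Bool.eq_iff_iff.2 ((hh i).symm.trans this)
    have h3 : ((s.image x).card : ℕ∞) ≤ d :=
      le_trans (le_iSup₂ (f := fun (s : Finset X) (_ : Shatters V s) => (s.card : ℕ∞)) _ hsh) hV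
    rw [Finset.card_image_of_injOn hinj] at h3
    exact_mod_cast h3
  calc _ ≤ 𝒜.card := h1
    _ ≤ 𝒜.shatterer.card := Finset.card_le_card_shatterer 𝒜
    _ ≤ ∑ k ∈ Finset.Iic 𝒜.vcDim, (Fintype.card ι).choose k :=
      Finset.card_shatterer_le_sum_vcDim
    _ ≤ (Fintype.card ι + 1) ^ 𝒜.vcDim := sum_Iic_choose_le _ _
    _ ≤ _ := Nat.pow_le_pow_right (Nat.succ_pos _) h2

theorem vcDim_mono {X : Type*} {V W : Set (X → Bool)} (h : V ⊆ W) : vcDim V ≤ vcDim W := by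
  refine iSup₂_le fun s hs => ?_
  refine le_iSup₂ (f := fun (s : Finset X) (_ : Shatters W s) => (s.card : ℕ∞)) s fun f => ?_
  obtain ⟨g, hg, hgs⟩ := hs f
  exact ⟨g, h hg, hgs⟩

/-- Patterns of differences of two functions from the class. -/
theorem ncard_difference_patterns_le {X Y ι : Type*} [Fintype ι] {V : Set (X → Bool)} {d : ℕ}
    (hV : vcDim V ≤ d) (π : Y → X) (x : ι → Y) :
    {c : ι → Bool | ∃ a ∈ {a : Y → Bool | ∃ h ∈ V, ∃ h' ∈ V,
      a = fun z => h (π z) != h' (π z)}, c = a ∘ x}.ncard ≤ (Fintype.card ι + 1) ^ (d * 2) := by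
  classical
  set Q := {c : ι → Bool | ∃ h ∈ V, c = h ∘ (π ∘ x)}
  have hsub : {c : ι → Bool | ∃ a ∈ {a : Y → Bool | ∃ h ∈ V, ∃ h' ∈ V,
      a = fun z => h (π z) != h' (π z)}, c = a ∘ x} ⊆
      (fun p : (ι → Bool) × (ι → Bool) => fun i => p.1 i != p.2 i) '' (Q ×ˢ Q) := by
    rintro c ⟨a, ⟨h, hh, h', hh', rfl⟩, rfl⟩
    exact ⟨(h ∘ (π ∘ x), h' ∘ (π ∘ x)), ⟨⟨h, hh, rfl⟩, ⟨h', hh', rfl⟩⟩, rfl⟩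
  calc _ ≤ _ := Set.ncard_le_ncard hsub (Set.toFinite _)
    _ ≤ (Q ×ˢ Q).ncard := Set.ncard_image_le (Set.toFinite _)
    _ = Q.ncard * Q.ncard := Set.ncard_prod
    _ ≤ (Fintype.card ι + 1) ^ d * (Fintype.card ι + 1) ^ d :=
      Nat.mul_le_mul (ncard_patterns_le hV _) (ncard_patterns_le hV _)
    _ = _ := by rw [pow_mul, sq]

/-- XOR with the fixed pattern of `f` creates no new patterns. The exponent `d * 1` has the shape
expected by `missed_event_le` with r = 1; differences use r = 2. -/
theorem ncard_error_patterns_le {X Y ι : Type*} [Fintype ι] {V : Set (X → Bool)} {d : ℕ}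
    (hV : vcDim V ≤ d) (f : X → Bool) (π : Y → X) (x : ι → Y) :
    {c : ι → Bool | ∃ a ∈ {a : Y → Bool | ∃ h ∈ V,
      a = fun z => h (π z) != f (π z)}, c = a ∘ x}.ncard ≤ (Fintype.card ι + 1) ^ (d * 1) := by
  classical
  set Q := {c : ι → Bool | ∃ h ∈ V, c = h ∘ (π ∘ x)}
  have hsub : {c : ι → Bool | ∃ a ∈ {a : Y → Bool | ∃ h ∈ V,
      a = fun z => h (π z) != f (π z)}, c = a ∘ x} ⊆
      (fun p : ι → Bool => fun i => p i != f (π (x i))) '' Q := by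
    rintro c ⟨a, ⟨h, hh, rfl⟩, rfl⟩
    exact ⟨h ∘ (π ∘ x), ⟨h, hh, rfl⟩, rfl⟩
  calc _ ≤ _ := Set.ncard_le_ncard hsub (Set.toFinite _)
    _ ≤ Q.ncard := Set.ncard_image_le (Set.toFinite _)
    _ ≤ _ := by rw [mul_one]; exact ncard_patterns_le hV _

end Growth

/-! ### The deviation bound in terms of `phi`. -/

section Deviation

/-- From log(1 + u) ≥ u - u²/2 at u = x/m: multiplied by m², the quadratic term is only x²/2 ≤ 1/2.
This is why a ghost sample of size m² costs just a constant factor. -/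
theorem exp_le_one_add_div_pow {m : ℕ} (hm : 0 < m) {x : ℝ} (hx : 0 ≤ x) (hx1 : x ≤ 1) :
    Real.exp (m * x - 1 / 2) ≤ (1 + x / m) ^ (m * m) := by
  have hm' : (0 : ℝ) < m := by exact_mod_cast hm
  have hu : 0 ≤ x / m := by positivity
  have h1 := Real.le_log_one_add_of_nonneg hu
  have h2 : x / m - (x / m) ^ 2 / 2 ≤ Real.log (1 + x / m) := by
    refine le_trans ?_ h1
    rw [le_div_iff₀ (by positivity)]
    nlinarith [pow_nonneg hu 3]
  rw [← Real.exp_log (by positivity : 0 < (1 + x / m) ^ (m * m)), Real.exp_le_exp, Real.log_pow]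
  push_cast
  have h3 : (m : ℝ) * m * (x / m - (x / m) ^ 2 / 2) = m * x - x ^ 2 / 2 := by
    field_simp
  nlinarith [mul_le_mul_of_nonneg_left h2 (by positivity : (0 : ℝ) ≤ m * m)]

theorem natCast_mul_phi {d m : ℕ} (hm : 0 < m) (δ : ℝ) :
    (m : ℝ) * phi d m δ = d * Real.log (Real.exp 1 * (m : ℝ) ^ 2) + Real.log (2 / δ) := by
  have hm' : (m : ℝ) ≠ 0 := by exact_mod_cast hm.ne'
  rw [phi]; field_simp

theorem log_exp_mul_sq {m : ℕ} (hm : 0 < m) :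
    Real.log (Real.exp 1 * (m : ℝ) ^ 2) = 1 + 2 * Real.log m := by
  have hm' : (m : ℝ) ≠ 0 := by exact_mod_cast hm.ne'
  rw [Real.log_mul (Real.exp_pos _).ne' (by positivity), Real.log_exp, Real.log_pow]
  norm_num

theorem phi_nonneg {d m : ℕ} {δ : ℝ} (hm : 0 < m) (hδ : 0 < δ) (hδ1 : δ ≤ 1) :
    0 ≤ phi d m δ := by
  have : (1 : ℝ) ≤ m := by exact_mod_cast hm
  rw [phi, log_exp_mul_sq hm]
  have := Real.log_nonneg this
  have : 0 ≤ Real.log (2 / δ) := Real.log_nonneg (by rw [le_div_iff₀ hδ]; linarith)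
  positivity

variable {Z : Type*} [MeasurableSpace Z]

/-- With threshold rφ, exp(m·rφ) equals (em²)^{dr}(2/δ)^r, whose first factor absorbs the number of
patterns. That needs m(m+1) + 1 ≤ em², which fails at m = 1. The leading 2 covers the lost factor
e^{1/2}. -/
theorem missed_event_le (P : Measure Z) [IsProbabilityMeasure P] (𝒜 : Set (Z → Bool))
    (hc : 𝒜.Countable) (hmeas : ∀ a ∈ 𝒜, Measurable a) {m : ℕ} (hm : 2 ≤ m) {d r : ℕ}
    (hΓ : ∀ x : Fin m × Fin (m + 1) → Z,
      {c : Fin m × Fin (m + 1) → Bool | ∃ a ∈ 𝒜, c = a ∘ x}.ncard ≤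
        (Fintype.card (Fin m × Fin (m + 1)) + 1) ^ (d * r))
    {δ : ℝ} (hδ : 0 < δ) (hδ1 : δ ≤ 1) {ι : Type*} {e : Fin m → ι} (he : Function.Injective e) :
    (Measure.infinitePi fun _ : ι => P)
      {u | ∃ a ∈ 𝒜, r * phi d m δ < P.real {z | a z = true} ∧ ∀ g, a (u (e g)) = false} ≤
      ENNReal.ofReal (2 * (δ / 2) ^ r) := by
  have hm0 : 0 < m := by omega
  have hm' : (2 : ℝ) ≤ m := by exact_mod_cast hm
  set φ : ℝ := r * phi d m δ with hφ
  have hφ0 : 0 ≤ φ := mul_nonneg (Nat.cast_nonneg _) (phi_nonneg hm0 hδ hδ1)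
  -- For φ > 1 no event has probability above φ; otherwise `exp_le_one_add_div_pow` applies.
  by_cases hφ1 : φ ≤ 1
  swap
  · have : {u : ι → Z | ∃ a ∈ 𝒜, φ < P.real {z | a z = true} ∧ ∀ g, a (u (e g)) = false} = ∅ := by
      ext u
      simp only [Set.mem_ofPred_eq, Set.mem_empty_iff_false, iff_false]
      rintro ⟨a, _, h, _⟩
      have : P.real {z | a z = true} ≤ 1 := measureReal_le_one
      linarith
    rw [this]; simp
  have hset : ∀ a ∈ 𝒜, ∀ b : Bool, MeasurableSet {z | a z = b} := fun a ha b =>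
    hmeas a ha (measurableSet_singleton b)
  have hB : MeasurableSet
      {u : Fin m → Z | ∃ a ∈ 𝒜, φ < P.real {z | a z = true} ∧ ∀ g, a (u g) = false} := by
    have : {u : Fin m → Z | ∃ a ∈ 𝒜, φ < P.real {z | a z = true} ∧ ∀ g, a (u g) = false} =
        ⋃ a ∈ 𝒜, {_u | φ < P.real {z | a z = true}} ∩ ⋂ g, {u | a (u g) = false} := by
      ext u
      simp only [Set.mem_ofPred_eq, Set.mem_iUnion, Set.mem_inter_iff, Set.mem_iInter,
        exists_prop]
    rw [this]
    refine MeasurableSet.biUnion hc fun a ha => (MeasurableSet.const _).inter ?_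
    exact MeasurableSet.iInter fun g => (measurable_pi_apply (X := fun _ => Z) g) (hset a ha false)
  have hmain := missed_event_bound P 𝒜 hc hmeas hm0 _ hΓ hφ0
  rw [← Measure.map_infinitePi_infinitePi_of_inj (P := fun _ : ι => P) he,
    Measure.map_apply (by fun_prop) hB] at hmain
  set q := (Measure.infinitePi fun _ : ι => P)
    {u | ∃ a ∈ 𝒜, φ < P.real {z | a z = true} ∧ ∀ g, a (u (e g)) = false}
  change q * _ ≤ _ at hmain
  have hq : q ≠ ⊤ := measure_ne_top _ _
  rw [← ENNReal.ofReal_toReal hq] at hmain ⊢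
  have hq0 : 0 ≤ q.toReal := ENNReal.toReal_nonneg
  apply ENNReal.ofReal_le_ofReal
  rw [← ENNReal.ofReal_pow (by positivity), ← ENNReal.ofReal_mul hq0,
    ← ENNReal.ofReal_natCast, ENNReal.ofReal_le_ofReal_iff (by positivity)] at hmain
  have h1 : q.toReal * Real.exp (m * φ - 1 / 2) ≤
      ((((Fintype.card (Fin m × Fin (m + 1)) + 1) ^ (d * r) : ℕ) : ℝ)) :=
    le_trans (mul_le_mul_of_nonneg_left (exp_le_one_add_div_pow hm0 hφ0 hφ1) hq0) hmain
  have hE : (2.7 : ℝ) ≤ Real.exp 1 := by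
    have := Real.exp_one_gt_d9; linarith
  have h2 : ((((Fintype.card (Fin m × Fin (m + 1)) + 1) ^ (d * r) : ℕ) : ℝ)) ≤
      (Real.exp 1 * (m : ℝ) ^ 2) ^ (d * r) := by
    push_cast
    refine pow_le_pow_left₀ (by positivity) ?_ _
    simp only [Fintype.card_prod, Fintype.card_fin]
    push_cast
    nlinarith [sq_nonneg ((m : ℝ) - 2)]
  have hmφ : (m : ℝ) * φ - 1 / 2 = Real.log ((Real.exp 1 * (m : ℝ) ^ 2) ^ (d * r) * (2 / δ) ^ r)
      - 1 / 2 := by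
    have hA : Real.exp 1 * (m : ℝ) ^ 2 ≠ 0 := by positivity
    have hD : 2 / δ ≠ 0 := by positivity
    rw [hφ, mul_left_comm, natCast_mul_phi hm0, Real.log_mul (pow_ne_zero _ hA) (pow_ne_zero _ hD),
      Real.log_pow, Real.log_pow]
    push_cast; ring
  rw [hmφ, Real.exp_sub, Real.exp_log (by positivity)] at h1
  have h3 : Real.exp (1 / 2) ≤ 2 := by
    have h4 : Real.exp (1 / 2) * Real.exp (1 / 2) = Real.exp 1 := by
      rw [← Real.exp_add]; norm_num
    have := Real.exp_one_lt_d9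
    have := Real.exp_pos (1 / 2)
    nlinarith
  have hA : 0 < (Real.exp 1 * (m : ℝ) ^ 2) ^ (d * r) := by positivity
  have h5 := h1.trans h2
  rw [← mul_div_assoc, div_le_iff₀ (Real.exp_pos _), mul_left_comm] at h5
  have h6 := le_of_mul_le_mul_left h5 hA
  have h7 : (δ / 2) ^ r * (2 / δ) ^ r = 1 := by
    rw [← mul_pow]; field_simp; simp
  have h8 : 0 < (δ / 2) ^ r := by positivity
  calc q.toReal = (q.toReal * (2 / δ) ^ r) * (δ / 2) ^ r := by
        rw [mul_assoc, mul_comm ((2 / δ) ^ r), h7, mul_one]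
    _ ≤ 2 * (δ / 2) ^ r := mul_le_mul_of_nonneg_right (h6.trans h3) h8.le

end Deviation

/-! ### Upper tail of the number of queried points. -/

section Chernoff

variable {Z : Type*} [MeasurableSpace Z]

theorem length_filter_map_range {Z : Type*} (m : ℕ) (f : ℕ → Z) (q : Z → Bool) :
    (((List.range m).map f).filter q).length =
      ((Finset.univ : Finset (Fin m)).filter fun g : Fin m => q (f g) = true).card := by
  rw [List.filter_map, List.length_map, ← List.toFinset_card_of_nodup
    ((List.nodup_range).filter _)]
  refine Finset.card_bij' (fun p hp => ⟨p, ?_⟩) (fun g _ => (g : ℕ)) ?_ ?_ ?_ ?_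
  · simp at hp; exact hp.1
  · intro p hp; simp at hp; simp [hp.2]
  · intro g hg; simp at hg; simp [hg]
  · intro p _; rfl
  · intro g _; rfl

/-- A Chernoff bound for the number of points of an independent sample in a fixed set. -/
theorem count_gt_le (P : Measure Z) [IsProbabilityMeasure P] {A : Set Z} (hA : MeasurableSet A)
    {ι : Type*} {m : ℕ} {e : Fin m → ι} (he : Function.Injective e) {δ : ℝ} (hδ : 0 < δ)
    (hδ1 : δ ≤ 1) (N : (ι → Z) → ℕ)
    (hN : ∀ u, ∃ s : Finset (Fin m), (∀ g, g ∈ s ↔ u (e g) ∈ A) ∧ N u = s.card) :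
    (Measure.infinitePi fun _ : ι => P)
      {u | 2 * (m * P.real A + Real.log (1 / δ)) < (N u : ℝ)} ≤ ENNReal.ofReal δ := by
  classical
  set μ := Measure.infinitePi fun _ : ι => P
  -- The product of `f` over the sample is 2^N, with mean (1 + p)^m ≤ e^{mp}. Markov's inequality is
  -- applied at level e^{mp}/δ, and 2 log 2 ≥ 1 gives the factor 2 in the threshold.
  let f : Z → ENNReal := fun z => 1 + A.indicator (fun _ => 1) z
  have hf : Measurable f := (measurable_const.indicator hA).const_add 1
  have hfi : ∫⁻ z, f z ∂P = ENNReal.ofReal (1 + P.real A) := by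
    simp only [f]
    rw [lintegral_add_left measurable_const, lintegral_indicator_const hA, lintegral_const,
      measure_univ, mul_one, one_mul, ENNReal.ofReal_add zero_le_one measureReal_nonneg,
      ENNReal.ofReal_one, Measure.real, ENNReal.ofReal_toReal (measure_ne_top _ _)]
  have hp0 : 0 ≤ P.real A := measureReal_nonneg
  have hmap : Measurable fun (u : ι → Z) (g : Fin m) => u (e g) := by fun_prop
  have hprod : ∫⁻ u, ∏ g, f (u (e g)) ∂μ ≤ ENNReal.ofReal (Real.exp (m * P.real A)) := by
    have h1 : ∫⁻ u, ∏ g, f (u (e g)) ∂μ = ENNReal.ofReal (1 + P.real A) ^ m := by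
      rw [← lintegral_map (μ := μ) (f := fun v : Fin m → Z => ∏ g, f (v g)) (by fun_prop) hmap,
        Measure.map_infinitePi_infinitePi_of_inj (P := fun _ : ι => P) he,
        lintegral_infinitePi_prod P (fun _ => f) fun _ => hf]
      simp [hfi]
    rw [h1, ← ENNReal.ofReal_pow (by positivity)]
    apply ENNReal.ofReal_le_ofReal
    rw [Real.exp_nat_mul]
    gcongr
    linarith [Real.add_one_le_exp (P.real A)]
  set a : ℝ := Real.exp (m * P.real A) / δ with ha
  have ha0 : 0 < a := by positivity
  have hsub : {u | 2 * (m * P.real A + Real.log (1 / δ)) < (N u : ℝ)} ⊆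
      {u | ENNReal.ofReal a ≤ ∏ g, f (u (e g))} := by
    intro u hu
    obtain ⟨s, hs, hNs⟩ := hN u
    have h1 : ∏ g, f (u (e g)) = ENNReal.ofReal (2 ^ N u) := by
      have : ∀ g, f (u (e g)) = if g ∈ s then 2 else 1 := by
        intro g
        by_cases hg : u (e g) ∈ A
        · simp only [f, Set.indicator_of_mem hg, (hs g).2 hg, if_true]; norm_num
        · simp only [f, Set.indicator_of_notMem hg, mt (hs g).1 hg, if_false]; norm_num
      simp_rw [this]
      rw [Finset.prod_ite, Finset.prod_const, Finset.prod_const_one, mul_one, hNs,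
        ENNReal.ofReal_pow (by norm_num)]
      simp
    simp only [Set.mem_ofPred_eq] at hu ⊢
    rw [h1]
    apply ENNReal.ofReal_le_ofReal
    have hl : 0 ≤ Real.log (1 / δ) := Real.log_nonneg (by rw [le_div_iff₀ hδ]; linarith)
    have h2 : a = Real.exp (m * P.real A + Real.log (1 / δ)) := by
      rw [Real.exp_add, Real.exp_log (by positivity)]; rw [ha]; ring
    have h3 : (2 : ℝ) ^ N u = Real.exp (N u * Real.log 2) := by
      rw [Real.exp_nat_mul, Real.exp_log (by norm_num)]
    rw [h2, h3, Real.exp_le_exp]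
    have := Real.log_two_gt_d9
    have : 0 ≤ m * P.real A + Real.log (1 / δ) := by positivity
    nlinarith
  calc _ ≤ μ {u | ENNReal.ofReal a ≤ ∏ g, f (u (e g))} := measure_mono hsub
    _ ≤ (∫⁻ u, ∏ g, f (u (e g)) ∂μ) / ENNReal.ofReal a :=
      meas_ge_le_lintegral_div (Finset.measurable_prod _ fun g _ =>
        hf.comp (measurable_pi_apply (e g))).aemeasurable (by simpa using ha0)
        ENNReal.ofReal_ne_top
    _ ≤ ENNReal.ofReal (Real.exp (m * P.real A)) / ENNReal.ofReal a := by gcongr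
    _ = ENNReal.ofReal δ := by
      rw [← ENNReal.ofReal_div_of_pos ha0, ha]
      congr 1
      field_simp

end Chernoff

/-! ### Independence of the draws of a batch from the past of the run. -/

section Visits

variable {X : Type*} (H : ℕ → Set (X → Bool)) (d : ℕ → ℕ)
  (search : ℕ → List (X × Bool) → Option (X × Bool)) (ε δ : ℝ)

/-- The configuration `s` is about to execute batch `j` of the CAL run of iteration `i`. -/
def AtBatch (i j : ℕ) (s : Config X) : Prop :=
  s.iter = i ∧ ∃ T, s.phase = Phase.cal j T

theorem step_of_phase_search {ω : ℕ × ℕ × ℕ → X × Bool} {s : Config X}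
    (h : s.phase = Phase.search) : step H d search ε δ ω s = searchStep H search ε s := by
  simp only [step, h]

theorem step_of_phase_cal {ω : ℕ × ℕ × ℕ → X × Bool} {s : Config X} {j : ℕ}
    {T : List (X × Bool)} (h : s.phase = Phase.cal j T) :
    step H d search ε δ ω s = calStep H d δ ω s j T := by
  simp only [step, h]

theorem step_of_phase_halted {ω : ℕ × ℕ × ℕ → X × Bool} {s : Config X}
    (h : s.phase = Phase.halted) : step H d search ε δ ω s = s := by
  simp only [step, h]

theorem searchStep_iter (s : Config X) : (searchStep H search ε s).iter = s.iter := by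
  unfold searchStep
  split
  · split_ifs <;> rfl
  · rfl

theorem calStep_iter_or (ω : ℕ × ℕ × ℕ → X × Bool) (s : Config X) (j : ℕ)
    (T : List (X × Bool)) :
    (calStep H d δ ω s j T).iter = s.iter + 1 ∨
      (calStep H d δ ω s j T).iter = s.iter ∧
        ∃ T', (calStep H d δ ω s j T).phase = Phase.cal (j + 1) T' := by
  unfold calStep
  dsimp only
  split_ifs
  · exact Or.inl rfl
  · exact Or.inr ⟨rfl, _, rfl⟩

/-- The configuration `s` lies beyond batch `j` of iteration `i`. -/
def BeyondBatch (i j : ℕ) (s : Config X) : Prop :=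
  i < s.iter ∨ s.iter = i ∧ ∃ j' > j, ∃ T, s.phase = Phase.cal j' T

variable {H d search ε δ}

theorem AtBatch.step {i j : ℕ} {s : Config X} (h : AtBatch i j s)
    (ω : ℕ × ℕ × ℕ → X × Bool) : BeyondBatch i j (step H d search ε δ ω s) := by
  obtain ⟨hi, T, hT⟩ := h
  rw [step_of_phase_cal _ _ _ _ _ hT]
  rcases calStep_iter_or H d δ ω s j T with h | ⟨h, T', h'⟩
  · left; omega
  · exact Or.inr ⟨by omega, j + 1, by omega, T', h'⟩

theorem BeyondBatch.step {i j : ℕ} {s : Config X} (h : BeyondBatch i j s)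
    (ω : ℕ × ℕ × ℕ → X × Bool) : BeyondBatch i j (step H d search ε δ ω s) := by
  rcases h with h | ⟨hi, j', hj, T, hT⟩
  · left
    cases hp : s.phase with
    | search => rw [step_of_phase_search _ _ _ _ _ hp, searchStep_iter]; exact h
    | halted => rw [step_of_phase_halted _ _ _ _ _ hp]; exact h
    | cal j T =>
      rw [step_of_phase_cal _ _ _ _ _ hp]
      rcases calStep_iter_or H d δ ω s j T with h | ⟨h, _⟩ <;> omega
  · rw [step_of_phase_cal _ _ _ _ _ hT]
    rcases calStep_iter_or H d δ ω s j' T with h | ⟨h, T', h'⟩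
    · left; omega
    · exact Or.inr ⟨by omega, j' + 1, by omega, T', h'⟩

theorem BeyondBatch.not_atBatch {i j : ℕ} {s : Config X} (h : BeyondBatch i j s) :
    ¬ AtBatch i j s := by
  rintro ⟨hi, T, hT⟩
  rcases h with h | ⟨_, j', hj, T', hT'⟩
  · omega
  · rw [hT] at hT'
    cases hT'
    omega

theorem beyondBatch_of_lt {i j t t' : ℕ} {ω : ℕ × ℕ × ℕ → X × Bool}
    (h : AtBatch i j (run H d search ε δ ω t)) (htt : t < t') :
    BeyondBatch i j (run H d search ε δ ω t') := by
  induction t', htt using Nat.le_induction with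
  | base => exact h.step ω
  | succ n _ ih => exact ih.step ω

/-- After batch j of iteration i the run stays lexicographically beyond (i, j), so every batch is
executed at most once. -/
theorem atBatch_unique {i j t t' : ℕ} {ω : ℕ × ℕ × ℕ → X × Bool}
    (h : AtBatch i j (run H d search ε δ ω t)) (h' : AtBatch i j (run H d search ε δ ω t')) :
    t = t' := by
  rcases lt_trichotomy t t' with hlt | heq | hlt
  · exact ((beyondBatch_of_lt h hlt).not_atBatch h').elim
  · exact heq
  · exact ((beyondBatch_of_lt h' hlt).not_atBatch h).elim

/-- The indices of the draws of batch `j` of iteration `i`. -/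
def batchIndices (i j : ℕ) : Set (ℕ × ℕ × ℕ) := {q | q.1 = i ∧ q.2.1 = j}

theorem step_congr {i j : ℕ} {ω ω' : ℕ × ℕ × ℕ → X × Bool}
    (hω : ∀ q ∉ batchIndices i j, ω q = ω' q) {s : Config X} (hs : ¬ AtBatch i j s) :
    step H d search ε δ ω s = step H d search ε δ ω' s := by
  cases hp : s.phase with
  | search => rw [step_of_phase_search _ _ _ _ _ hp, step_of_phase_search _ _ _ _ _ hp]
  | halted => rw [step_of_phase_halted _ _ _ _ _ hp, step_of_phase_halted _ _ _ _ _ hp]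
  | cal j' T =>
    rw [step_of_phase_cal _ _ _ _ _ hp, step_of_phase_cal _ _ _ _ _ hp]
    have : batch ω s.iter j' = batch ω' s.iter j' := by
      refine List.map_congr_left fun p _ => hω _ ?_
      rintro ⟨h1, h2⟩
      simp only at h1 h2
      exact hs ⟨h1, T, h2 ▸ hp⟩
    unfold calStep
    rw [this]

/-- The draws of a batch are not read before the batch is started. -/
theorem run_congr {i j : ℕ} {ω ω' : ℕ × ℕ × ℕ → X × Bool}
    (hω : ∀ q ∉ batchIndices i j, ω q = ω' q) {t : ℕ}
    (ht : ∀ t' < t, ¬ AtBatch i j (run H d search ε δ ω t')) :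
    run H d search ε δ ω t = run H d search ε δ ω' t := by
  induction t with
  | zero => rfl
  | succ n ih =>
    have h := ih fun t' ht' => ht t' (by omega)
    simp only [run]
    rw [← h]
    exact step_congr hω (ht n (by omega))

/-- The draws of a batch are independent of the configuration in which the batch is started. -/
theorem infinitePi_atBatch_le [MeasurableSpace X] (D : Measure (X × Bool))
    [IsProbabilityMeasure D] (i j : ℕ) (Bad : Config X → (ℕ × ℕ × ℕ → X × Bool) → Prop)
    (hcongr : ∀ s ω ω', (∀ p, ω (i, j, p) = ω' (i, j, p)) → Bad s ω → Bad s ω') {η : ENNReal}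
    (hη : ∀ s, AtBatch i j s → (Measure.infinitePi fun _ : ℕ × ℕ × ℕ => D) {ω | Bad s ω} ≤ η)
    (hmeas : ∀ t, MeasurableSet {ω | AtBatch i j (run H d search ε δ ω t) ∧
      Bad (run H d search ε δ ω t) ω}) :
    (Measure.infinitePi fun _ : ℕ × ℕ × ℕ => D)
      {ω | ∃ t, AtBatch i j (run H d search ε δ ω t) ∧ Bad (run H d search ε δ ω t) ω} ≤ η := by
  have hE : MeasurableSet
      {ω | ∃ t, AtBatch i j (run H d search ε δ ω t) ∧ Bad (run H d search ε δ ω t) ω} := by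
    have := MeasurableSet.iUnion hmeas
    convert this using 1
    ext ω; simp
  refine infinitePi_le_of_merge_le D (batchIndices i j) hE fun u => ?_
  have hag : ∀ v, ∀ q ∉ batchIndices i j, u q = merge (batchIndices i j) u v q := by
    intro v q hq
    simp [merge, hq]
  -- Whether, when and in which configuration the batch is reached is decided by `u` alone. Once `u`
  -- is fixed, the configuration is a constant and only the fresh draws of the batch matter.
  by_cases hex : ∃ t, AtBatch i j (run H d search ε δ u t)
  · obtain ⟨t₀, ht₀⟩ := hex
    refine le_trans (measure_mono ?_) (hη _ ht₀)
    rintro v ⟨t, hat, hbad⟩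
    have h0 : run H d search ε δ u t₀ =
        run H d search ε δ (merge (batchIndices i j) u v) t₀ :=
      run_congr (hag v) fun t' ht' hat' => absurd (atBatch_unique hat' ht₀) (by omega)
    have htt : t = t₀ := atBatch_unique hat (h0 ▸ ht₀)
    rw [htt, ← h0] at hbad
    refine hcongr _ _ _ (fun p => ?_) hbad
    simp [merge, batchIndices]
  · push Not at hex
    have : {v | merge (batchIndices i j) u v ∈ {ω | ∃ t, AtBatch i j (run H d search ε δ ω t) ∧
        Bad (run H d search ε δ ω t) ω}} = ∅ := by
      ext v
      simp only [Set.mem_ofPred_eq, Set.mem_empty_iff_false, iff_false]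
      rintro ⟨t, hat, _⟩
      rw [← run_congr (hag v) fun t' _ => hex t'] at hat
      exact hex t hat
    rw [this]; simp

end Visits

/-! ### Measurability for finite sequences of examples. -/

section Lists

variable {Ω Z : Type*} [MeasurableSpace Ω] [MeasurableSpace Z]

/-- The σ-algebra on finite sequences that is generated by the entries. -/
instance listMeasurableSpace : MeasurableSpace (List Z) :=
  MeasurableSpace.generateFrom
    {s | ∃ (i : ℕ) (A : Set Z), MeasurableSet A ∧ s = {l | ∃ z ∈ A, l[i]? = some z}}

theorem measurableSet_exists_getElem? (i : ℕ) {A : Set Z} (hA : MeasurableSet A) :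
    MeasurableSet {l : List Z | ∃ z ∈ A, l[i]? = some z} :=
  MeasurableSpace.measurableSet_generateFrom ⟨i, A, hA, rfl⟩

theorem measurable_list_of_getElem? {f : Ω → List Z}
    (h : ∀ (i : ℕ) (A : Set Z), MeasurableSet A →
      MeasurableSet {ω | ∃ z ∈ A, (f ω)[i]? = some z}) : Measurable f := by
  refine measurable_generateFrom ?_
  rintro _ ⟨i, A, hA, rfl⟩
  exact h i A hA

theorem measurable_list_length : Measurable (List.length : List Z → ℕ) := by
  refine measurable_of_Ioi fun n => ?_
  convert measurableSet_exists_getElem? n (MeasurableSet.univ (α := Z)) using 1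
  ext l
  simp only [Set.mem_preimage, Set.mem_Ioi, Set.mem_ofPred_eq, Set.mem_univ, true_and]
  constructor
  · intro h; exact ⟨l[n], List.getElem?_eq_getElem h⟩
  · rintro ⟨z, hz⟩; exact (List.getElem?_eq_some_iff.1 hz).1

theorem _root_.Measurable.list_append {f g : Ω → List Z} (hf : Measurable f) (hg : Measurable g) :
    Measurable fun ω => f ω ++ g ω := by
  refine measurable_list_of_getElem? fun i A hA => ?_
  have hl : Measurable fun ω => (f ω).length := measurable_list_length.comp hf
  have : {ω | ∃ z ∈ A, (f ω ++ g ω)[i]? = some z} =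
      ({ω | i < (f ω).length} ∩ {ω | ∃ z ∈ A, (f ω)[i]? = some z}) ∪
        ⋃ n : ℕ, ({ω | (f ω).length = n ∧ n ≤ i} ∩ {ω | ∃ z ∈ A, (g ω)[i - n]? = some z}) := by
    ext ω
    simp only [List.getElem?_append, Set.mem_ofPred_eq, Set.mem_union, Set.mem_inter_iff,
      Set.mem_iUnion]
    split_ifs with h
    · simp only [h, true_and, iff_self_or]
      rintro ⟨n, ⟨rfl, hn⟩, _⟩
      omega
    · simp only [h, false_and, false_or]
      constructor
      · intro hz; exact ⟨_, ⟨rfl, by omega⟩, hz⟩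
      · rintro ⟨n, ⟨rfl, hn⟩, hz⟩; exact hz
  rw [this]
  refine MeasurableSet.union ?_ (MeasurableSet.iUnion fun n => ?_)
  · exact (measurableSet_lt measurable_const hl).inter
      (hf (measurableSet_exists_getElem? i hA))
  · refine MeasurableSet.inter ?_ (hg (measurableSet_exists_getElem? _ hA))
    exact (hl (measurableSet_singleton n)).inter (MeasurableSet.const _)

theorem _root_.Measurable.list_singleton {f : Ω → Z} (hf : Measurable f) :
    Measurable fun ω => [f ω] := by
  refine measurable_list_of_getElem? fun i A hA => ?_
  cases i with
  | zero =>
    convert hf hA using 1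
    ext ω
    rw [Set.mem_ofPred_eq, Set.mem_preimage]
    simp only [List.length_cons, List.length_nil, zero_add, Nat.lt_one_iff,
      getElem?_pos, List.getElem_cons_zero, Option.some.injEq, exists_eq_right']
  | succ n => simp

theorem measurable_list_filter {f : ℕ → Ω → Z} (hf : ∀ p, Measurable (f p)) {q : Ω → Z → Bool}
    (hq : ∀ p, MeasurableSet {ω | q ω (f p ω) = true}) (I : List ℕ) :
    Measurable fun ω => (I.map fun p => f p ω).filter (q ω) := by
  induction I with
  | nil => simp
  | cons p I ih =>
    have : (fun ω => ((p :: I).map fun p => f p ω).filter (q ω)) =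
        fun ω => (if q ω (f p ω) = true then [f p ω] else []) ++
          (I.map fun p => f p ω).filter (q ω) := by
      funext ω
      simp only [List.map_cons, List.filter_cons]
      split_ifs <;> simp
    rw [this]
    exact Measurable.list_append (Measurable.ite (hq p) (hf p).list_singleton measurable_const) ih

theorem measurableSet_forall_mem {A : Set Z} (hA : MeasurableSet A) :
    MeasurableSet {l : List Z | ∀ z ∈ l, z ∈ A} := by
  have : {l : List Z | ∀ z ∈ l, z ∈ A} =
      ⋂ i : ℕ, {l : List Z | ∃ z ∈ Aᶜ, l[i]? = some z}ᶜ := by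
    ext l
    simp only [Set.mem_ofPred_eq, Set.mem_iInter, Set.mem_compl_iff, not_exists, not_and]
    constructor
    · intro h i z hz hl; exact hz (h z (List.mem_iff_getElem?.2 ⟨i, hl⟩))
    · intro h z hz
      obtain ⟨i, hi⟩ := List.mem_iff_getElem?.1 hz
      by_contra hzA
      exact h i z hzA hi
  rw [this]
  exact MeasurableSet.iInter fun i => (measurableSet_exists_getElem? i hA.compl).compl

theorem measurable_list_getD (z₀ : Z) (i : ℕ) : Measurable fun l : List Z => l.getD i z₀ := by
  intro A hA
  have : (fun l : List Z => l.getD i z₀) ⁻¹' A = {l | ∃ z ∈ A, l[i]? = some z} ∪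
      ({l | ∃ z ∈ univ, l[i]? = some z}ᶜ ∩ {_l | z₀ ∈ A}) := by
    ext l
    simp only [Set.mem_preimage, List.getD_eq_getElem?_getD, Set.mem_union, Set.mem_ofPred_eq,
      Set.mem_inter_iff, Set.mem_compl_iff, Set.mem_univ, true_and]
    cases h : l[i]? <;> simp
  rw [this]
  exact (measurableSet_exists_getElem? i hA).union
    ((measurableSet_exists_getElem? i MeasurableSet.univ).compl.inter (MeasurableSet.const _))

/-- It allows the discrete components of a configuration to be treated as constants: on each of the
countably many fibres of `Q`, a globally measurable substitute is enough. -/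
theorem measurable_of_countable_cover {α β : Type*} [MeasurableSpace α] [Countable β]
    [MeasurableSpace β] [MeasurableSingletonClass β] {Q : Ω → β} (hQ : Measurable Q) {f : Ω → α}
    (h : ∀ b, ∃ g : Ω → α, Measurable g ∧ ∀ ω, Q ω = b → f ω = g ω) : Measurable f := by
  choose g hg hfg using h
  intro A hA
  have : f ⁻¹' A = ⋃ b, (Q ⁻¹' {b}) ∩ (g b) ⁻¹' A := by
    ext ω
    simp only [Set.mem_preimage, Set.mem_iUnion, Set.mem_inter_iff, Set.mem_singleton_iff]
    constructor
    · intro h; exact ⟨Q ω, rfl, by rwa [← hfg _ ω rfl]⟩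
    · rintro ⟨b, hb, h⟩; rwa [hfg b ω hb]
  rw [this]
  exact MeasurableSet.iUnion fun b => (hQ (measurableSet_singleton b)).inter (hg b hA)

theorem measurable_nat_sInf {s : Ω → Set ℕ} (hs : ∀ n, MeasurableSet {ω | n ∈ s ω}) :
    Measurable fun ω => sInf (s ω) := by
  refine measurable_to_countable' fun n => ?_
  -- The second piece accounts for the default value `sInf ∅ = 0`.
  have : (fun ω => sInf (s ω)) ⁻¹' {n} =
      ({ω | n ∈ s ω} ∩ ⋂ m : ℕ, ⋂ _ : m < n, {ω | m ∈ s ω}ᶜ) ∪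
        ({_ω | n = 0} ∩ ⋂ m : ℕ, {ω | m ∈ s ω}ᶜ) := by
    ext ω
    simp only [Set.mem_preimage, Set.mem_singleton_iff, Set.mem_union, Set.mem_inter_iff,
      Set.mem_ofPred_eq, Set.mem_iInter, Set.mem_compl_iff]
    constructor
    · rintro rfl
      by_cases hne : (s ω).Nonempty
      · exact Or.inl ⟨Nat.sInf_mem hne, fun m hm => Nat.notMem_of_lt_sInf hm⟩
      · rw [Set.not_nonempty_iff_eq_empty] at hne
        right; simp [hne]
    · rintro (⟨h1, h2⟩ | ⟨rfl, h⟩)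
      · refine le_antisymm (Nat.sInf_le h1) ?_
        by_contra hlt
        exact h2 _ (not_le.1 hlt) (Nat.sInf_mem ⟨n, h1⟩)
      · rw [Nat.sInf_eq_zero]
        right
        ext m; simpa using h m
  rw [this]
  refine MeasurableSet.union ((hs n).inter ?_) ((MeasurableSet.const _).inter ?_)
  · exact MeasurableSet.iInter fun m => MeasurableSet.iInter fun _ => (hs m).compl
  · exact MeasurableSet.iInter fun m => (hs m).compl

end Lists

/-! ### Reduction of version spaces to countable subclasses. -/

section VersionSpaces

variable {X : Type*}

/-- The set `U` is a countable subclass witnessing the pointwise separability of `V`. -/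
def CountablyApproximates (U V : Set (X → Bool)) : Prop :=
  U ⊆ V ∧ U.Countable ∧ ∀ h ∈ V, ∃ g : ℕ → X → Bool,
    (∀ n, g n ∈ U) ∧ ∀ x, ∀ᶠ n in atTop, g n x = h x

theorem versionSpace_versionSpace (V : Set (X → Bool)) (S T : List (X × Bool)) :
    versionSpace (versionSpace V S) T = versionSpace V (S ++ T) := by
  ext h
  simp only [versionSpace, Set.mem_ofPred_eq, List.mem_append, and_assoc, or_imp, forall_and]

theorem eventually_forall_mem {α : Type*} {g : ℕ → X → Bool} {h : X → Bool}
    (hg : ∀ x, ∀ᶠ n in atTop, g n x = h x) (π : α → X) (l : List α) :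
    ∀ᶠ n in atTop, ∀ a ∈ l, g n (π a) = h (π a) := by
  induction l with
  | nil => simp
  | cons a l ih =>
    filter_upwards [hg (π a), ih] with n h1 h2
    simpa using ⟨h1, h2⟩

/-- Labels are discrete, so a pointwise convergent sequence is eventually exact on the finitely many
examples of `S`. The quantifier over the class becomes countable. -/
theorem versionSpace_nonempty_iff {U V : Set (X → Bool)} (hU : CountablyApproximates U V)
    (S : List (X × Bool)) :
    (versionSpace V S).Nonempty ↔ ∃ h ∈ U, ∀ p ∈ S, h p.1 = p.2 := by
  constructor
  · rintro ⟨h, hV, hS⟩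
    obtain ⟨g, hg, hgh⟩ := hU.2.2 h hV
    obtain ⟨n, hn⟩ := (eventually_forall_mem hgh Prod.fst S).exists
    exact ⟨g n, hg n, fun p hp => (hn p hp).trans (hS p hp)⟩
  · rintro ⟨h, hh, hS⟩
    exact ⟨h, hU.1 hh, hS⟩

theorem mem_disagreement_iff {U V : Set (X → Bool)} (hU : CountablyApproximates U V)
    (S : List (X × Bool)) (x : X) :
    x ∈ disagreement (versionSpace V S) ↔ ∃ h ∈ U, ∃ h' ∈ U,
      (∀ p ∈ S, h p.1 = p.2) ∧ (∀ p ∈ S, h' p.1 = p.2) ∧ h x ≠ h' x := by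
  constructor
  · rintro ⟨h, ⟨hV, hS⟩, h', ⟨hV', hS'⟩, hne⟩
    obtain ⟨g, hg, hgh⟩ := hU.2.2 h hV
    obtain ⟨g', hg', hgh'⟩ := hU.2.2 h' hV'
    obtain ⟨n, hn, hx⟩ := ((eventually_forall_mem hgh Prod.fst S).and (hgh x)).exists
    obtain ⟨n', hn', hx'⟩ := ((eventually_forall_mem hgh' Prod.fst S).and (hgh' x)).exists
    exact ⟨g n, hg n, g' n', hg' n', fun p hp => (hn p hp).trans (hS p hp),
      fun p hp => (hn' p hp).trans (hS' p hp), by rwa [hx, hx']⟩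
  · rintro ⟨h, hh, h', hh', hS, hS', hne⟩
    exact ⟨h, ⟨hU.1 hh, hS⟩, h', ⟨hU.1 hh', hS'⟩, hne⟩

variable [MeasurableSpace X]

theorem measurableSet_consistent {h : X → Bool} (hh : Measurable h) :
    MeasurableSet {S : List (X × Bool) | ∀ p ∈ S, h p.1 = p.2} :=
  measurableSet_forall_mem (A := {p : X × Bool | h p.1 = p.2})
    (measurableSet_eq_fun (hh.comp measurable_fst) measurable_snd)

theorem measurableSet_versionSpace_nonempty {U V : Set (X → Bool)}
    (hU : CountablyApproximates U V) (hV : ∀ h ∈ V, Measurable h) :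
    MeasurableSet {S : List (X × Bool) | (versionSpace V S).Nonempty} := by
  have : {S : List (X × Bool) | (versionSpace V S).Nonempty} =
      ⋃ h ∈ U, {S : List (X × Bool) | ∀ p ∈ S, h p.1 = p.2} := by
    ext S; simp [versionSpace_nonempty_iff hU]
  rw [this]
  exact MeasurableSet.biUnion hU.2.1 fun h hh => measurableSet_consistent (hV h (hU.1 hh))

theorem measurableSet_mem_disagreement {U V : Set (X → Bool)}
    (hU : CountablyApproximates U V) (hV : ∀ h ∈ V, Measurable h) :
    MeasurableSet {q : List (X × Bool) × X | q.2 ∈ disagreement (versionSpace V q.1)} := by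
  have : {q : List (X × Bool) × X | q.2 ∈ disagreement (versionSpace V q.1)} =
      ⋃ h ∈ U, ⋃ h' ∈ U, ((Prod.fst ⁻¹' {S : List (X × Bool) | ∀ p ∈ S, h p.1 = p.2}) ∩
        ((Prod.fst ⁻¹' {S : List (X × Bool) | ∀ p ∈ S, h' p.1 = p.2}) ∩
          (Prod.snd ⁻¹' {x | h x ≠ h' x}))) := by
    ext q
    simp only [Set.mem_ofPred_eq, mem_disagreement_iff hU, Set.mem_iUnion, Set.mem_inter_iff,
      Set.mem_preimage, exists_prop]
  rw [this]
  refine MeasurableSet.biUnion hU.2.1 fun h hh => MeasurableSet.biUnion hU.2.1 fun h' hh' => ?_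
  have hm := hV h (hU.1 hh)
  have hm' := hV h' (hU.1 hh')
  exact (measurable_fst (measurableSet_consistent hm)).inter
    ((measurable_fst (measurableSet_consistent hm')).inter
      (measurable_snd (measurableSet_eq_fun hm hm').compl))

/-- The answer is encoded as a list of length at most one, ready to be appended to S.
`MeasurableOracle` speaks of tuples of fixed length, so queries are split by length; `z₀` is only a
default entry. -/
theorem measurable_search {search : ℕ → List (X × Bool) → Option (X × Bool)}
    (hs : MeasurableOracle search) (z₀ : X × Bool) (k : ℕ) :
    Measurable fun S => (search k S).toList := by
  refine measurable_list_of_getElem? fun i A hA => ?_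
  cases i with
  | succ n =>
    convert MeasurableSet.empty using 1
    ext S
    rcases h : search k S with _ | e <;> simp [h]
  | zero =>
    have : {S | ∃ z ∈ A, (search k S).toList[0]? = some z} =
        ⋃ n : ℕ, (List.length ⁻¹' {n}) ∩
          ((fun (S : List (X × Bool)) (i : Fin n) => S.getD i z₀) ⁻¹'
            {v | ∃ e ∈ A, search k (List.ofFn v) = some e}) := by
      ext S
      have h1 : List.ofFn (fun i : Fin S.length => S.getD i z₀) = S := by
        apply List.ext_getElem <;> simp
      have h2 : ∀ z, (search k S).toList[0]? = some z ↔ search k S = some z := by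
        intro z; cases search k S <;> simp
      simp only [Set.mem_ofPred_eq, h2, Set.mem_iUnion, Set.mem_inter_iff, Set.mem_preimage,
        Set.mem_singleton_iff]
      constructor
      · intro h; exact ⟨S.length, rfl, by rwa [h1]⟩
      · rintro ⟨n, rfl, h⟩; rwa [h1] at h
    rw [this]
    refine MeasurableSet.iUnion fun n =>
      (measurable_list_length (measurableSet_singleton n)).inter ?_
    exact (measurable_pi_lambda _ fun i : Fin n => measurable_list_getD z₀ i) (hs k n A hA)

end VersionSpaces

/-! ### Measurability of the run. -/

section Runs

variable {X Ω : Type*}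

/-- The control state as a number, with the recorded examples left out. -/
def phaseTag : Phase X → ℕ
  | Phase.search => 0
  | Phase.halted => 1
  | Phase.cal j _ => j + 2

/-- The examples collected by the current run of CAL. -/
def phaseSamples : Phase X → List (X × Bool)
  | Phase.cal _ T => T
  | _ => []

open Classical in
/-- The examples whose labels are queried in batch `j`. -/
noncomputable def queried (H : ℕ → Set (X → Bool)) (ω : ℕ × ℕ × ℕ → X × Bool)
    (k i j : ℕ) (S T : List (X × Bool)) : List (X × Bool) :=
  (batch ω i j).filter fun p =>
    decide (p.1 ∈ disagreement (versionSpace (versionSpace (H k) S) T))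

/-- The confidence parameter of batch `j` in iteration `i`. -/
noncomputable def batchDelta (δ : ℝ) (i j : ℕ) : ℝ :=
  δ / ((i : ℝ) ^ 2 + i) / ((j : ℝ) * (j + 1))

/-- The condition under which CAL stops after batch `j`. -/
def CalStops (H : ℕ → Set (X → Bool)) (d : ℕ → ℕ) (δ : ℝ) (ω : ℕ × ℕ × ℕ → X × Bool)
    (k l i j : ℕ) (S T : List (X × Bool)) : Prop :=
  phi (d k) (2 ^ j) (batchDelta δ i j / 2) ≤ (2 : ℝ)⁻¹ ^ l ∨
    versionSpace (versionSpace (H k) S) (T ++ queried H ω k i j S T) = ∅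

open Classical in
theorem calStep_eq (H : ℕ → Set (X → Bool)) (d : ℕ → ℕ) (δ : ℝ) (ω : ℕ × ℕ × ℕ → X × Bool)
    (s : Config X) (j : ℕ) (T : List (X × Bool)) :
    calStep H d δ ω s j T =
      if CalStops H d δ ω s.k s.l s.iter j s.S T then
        { s with
          S := s.S ++ (T ++ queried H ω s.k s.iter j s.S T)
          iter := s.iter + 1
          phase := Phase.search
          draws := s.draws + 2 ^ j
          labels := s.labels + (queried H ω s.k s.iter j s.S T).length }
      else
        { s with
          phase := Phase.cal (j + 1) (T ++ queried H ω s.k s.iter j s.S T)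
          draws := s.draws + 2 ^ j
          labels := s.labels + (queried H ω s.k s.iter j s.S T).length } := by
  unfold calStep CalStops queried batchDelta
  dsimp only
  congr

variable [MeasurableSpace X] [MeasurableSpace Ω]

/-- Measurability of those parts of a random configuration that determine its evolution. -/
structure MeasurableConfig (F : Ω → Config X) : Prop where
  S : Measurable fun ω => (F ω).S
  T : Measurable fun ω => phaseSamples (F ω).phase
  k : Measurable fun ω => (F ω).k
  l : Measurable fun ω => (F ω).l
  iter : Measurable fun ω => (F ω).iter
  tag : Measurable fun ω => phaseTag (F ω).phase

theorem MeasurableConfig.ite {p : Ω → Prop} [DecidablePred p] (hp : MeasurableSet {ω | p ω})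
    {F G : Ω → Config X} (hF : MeasurableConfig F) (hG : MeasurableConfig G) :
    MeasurableConfig fun ω => if p ω then F ω else G ω := by
  constructor
  · simp only [apply_ite Config.S]; exact Measurable.ite hp hF.S hG.S
  · simp only [apply_ite Config.phase, apply_ite phaseSamples]; exact Measurable.ite hp hF.T hG.T
  · simp only [apply_ite Config.k]; exact Measurable.ite hp hF.k hG.k
  · simp only [apply_ite Config.l]; exact Measurable.ite hp hF.l hG.l
  · simp only [apply_ite Config.iter]; exact Measurable.ite hp hF.iter hG.iter
  · simp only [apply_ite Config.phase, apply_ite phaseTag]; exact Measurable.ite hp hF.tag hG.tag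

theorem MeasurableConfig.of_countable_cover {β : Type*} [Countable β]
    [MeasurableSpace β] [MeasurableSingletonClass β] {Q : Ω → β} (hQ : Measurable Q)
    {F : Ω → Config X}
    (h : ∀ b, ∃ G : Ω → Config X, MeasurableConfig G ∧ ∀ ω, Q ω = b → F ω = G ω) :
    MeasurableConfig F := by
  choose G hG hFG using h
  constructor
  · exact measurable_of_countable_cover hQ fun b => ⟨_, (hG b).S, fun ω hω => by rw [hFG b ω hω]⟩
  · exact measurable_of_countable_cover hQ fun b => ⟨_, (hG b).T, fun ω hω => by rw [hFG b ω hω]⟩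
  · exact measurable_of_countable_cover hQ fun b => ⟨_, (hG b).k, fun ω hω => by rw [hFG b ω hω]⟩
  · exact measurable_of_countable_cover hQ fun b => ⟨_, (hG b).l, fun ω hω => by rw [hFG b ω hω]⟩
  · exact measurable_of_countable_cover hQ fun b =>
      ⟨_, (hG b).iter, fun ω hω => by rw [hFG b ω hω]⟩
  · exact measurable_of_countable_cover hQ fun b =>
      ⟨_, (hG b).tag, fun ω hω => by rw [hFG b ω hω]⟩

variable {H U : ℕ → Set (X → Bool)} {d : ℕ → ℕ}
  {search : ℕ → List (X × Bool) → Option (X × Bool)} {ε δ : ℝ}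

theorem measurableSet_mem_disagreement_comp (hU : ∀ k, CountablyApproximates (U k) (H k))
    (hH : ∀ k, ∀ h ∈ H k, Measurable h) (k : ℕ) {S T : Ω → List (X × Bool)}
    (hS : Measurable S) (hT : Measurable T) {x : Ω → X} (hx : Measurable x) :
    MeasurableSet
      {ω | x ω ∈ disagreement (versionSpace (versionSpace (H k) (S ω)) (T ω))} := by
  simp only [versionSpace_versionSpace]
  exact ((hS.list_append hT).prodMk hx) (measurableSet_mem_disagreement (hU k) (hH k))

theorem measurable_queried (hU : ∀ k, CountablyApproximates (U k) (H k))
    (hH : ∀ k, ∀ h ∈ H k, Measurable h) (k i j : ℕ)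
    {S T : (ℕ × ℕ × ℕ → X × Bool) → List (X × Bool)} (hS : Measurable S) (hT : Measurable T) :
    Measurable fun ω => queried H ω k i j (S ω) (T ω) := by
  classical
  refine measurable_list_filter (fun p => measurable_pi_apply (i, j, p)) (fun p => ?_) _
  simp only [decide_eq_true_eq]
  exact measurableSet_mem_disagreement_comp hU hH k hS hT
    (measurable_fst.comp (measurable_pi_apply (i, j, p)))

theorem MeasurableConfig.step (hU : ∀ k, CountablyApproximates (U k) (H k))
    (hH : ∀ k, ∀ h ∈ H k, Measurable h) (hs : MeasurableOracle search) (z₀ : X × Bool)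
    {F : (ℕ × ℕ × ℕ → X × Bool) → Config X} (hF : MeasurableConfig F) :
    MeasurableConfig fun ω => step H d search ε δ ω (F ω) := by
  classical
  refine MeasurableConfig.of_countable_cover
    (hF.k.prodMk (hF.l.prodMk (hF.iter.prodMk hF.tag))) ?_
  -- On each fibre the indices are constants and the branch is known from the tag: 0 for SEARCH, 1
  -- for halted, j + 2 for batch j.
  rintro ⟨k, l, i, τ⟩
  match τ with
  | 0 =>
    have hsearch : Measurable fun ω => (search k (F ω).S).toList :=
      (measurable_search hs z₀ k).comp hF.S
    have hS := hF.S.list_append hsearch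
    refine ⟨fun ω => if search k (F ω).S = none then
        (if (2 : ℝ)⁻¹ ^ l ≤ ε then
          { F ω with phase := Phase.halted, searches := (F ω).searches + 1 }
        else { F ω with
          l := l + 1, phase := Phase.cal 1 [], searches := (F ω).searches + 1 })
      else { F ω with
        S := (F ω).S ++ (search k (F ω).S).toList
        k := sInf {k' | (versionSpace (H k') ((F ω).S ++ (search k (F ω).S).toList)).Nonempty}
        phase := Phase.cal 1 []
        searches := (F ω).searches + 1 }, ?_, ?_⟩
    · refine MeasurableConfig.ite ?_ (MeasurableConfig.ite (MeasurableSet.const _) ?_ ?_) ?_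
      · have := (measurable_list_length.comp hsearch) (measurableSet_singleton 0)
        convert this using 1
        ext ω
        simp only [Set.mem_ofPred_eq, Set.mem_preimage, Function.comp, Set.mem_singleton_iff]
        cases search k (F ω).S <;> simp
      · exact ⟨hF.S, measurable_const, hF.k, hF.l, hF.iter, measurable_const⟩
      · exact ⟨hF.S, measurable_const, hF.k, measurable_const, hF.iter, measurable_const⟩
      · refine ⟨hS, measurable_const, measurable_nat_sInf fun n => ?_, hF.l, hF.iter,
          measurable_const⟩
        exact hS (measurableSet_versionSpace_nonempty (hU n) (hH n))
    · intro ω hω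
      simp only [Prod.mk.injEq] at hω
      obtain ⟨rfl, rfl, rfl, hτ⟩ := hω
      have hp : (F ω).phase = Phase.search := by
        cases h : (F ω).phase <;> simp [h, phaseTag] at hτ ⊢
      rw [step_of_phase_search _ _ _ _ _ hp]
      unfold searchStep
      cases h : search (F ω).k (F ω).S <;> simp [h]
  | 1 =>
    refine ⟨F, hF, fun ω hω => ?_⟩
    simp only [Prod.mk.injEq] at hω
    have hp : (F ω).phase = Phase.halted := by
      have := hω.2.2.2
      cases h : (F ω).phase <;> simp [h, phaseTag] at this ⊢
    rw [step_of_phase_halted _ _ _ _ _ hp]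
  | j + 2 =>
    have hq := measurable_queried hU hH k i j hF.S hF.T
    refine ⟨fun ω => if CalStops H d δ ω k l i j (F ω).S (phaseSamples (F ω).phase) then
        { F ω with
          S := (F ω).S ++ (phaseSamples (F ω).phase ++
            queried H ω k i j (F ω).S (phaseSamples (F ω).phase))
          iter := i + 1
          phase := Phase.search
          draws := (F ω).draws + 2 ^ j
          labels := (F ω).labels +
            (queried H ω k i j (F ω).S (phaseSamples (F ω).phase)).length }
      else
        { F ω with
          phase := Phase.cal (j + 1) (phaseSamples (F ω).phase ++
            queried H ω k i j (F ω).S (phaseSamples (F ω).phase))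
          draws := (F ω).draws + 2 ^ j
          labels := (F ω).labels +
            (queried H ω k i j (F ω).S (phaseSamples (F ω).phase)).length }, ?_, ?_⟩
    · refine MeasurableConfig.ite ?_ ?_ ?_
      · have hempty : MeasurableSet {ω | versionSpace (versionSpace (H k) (F ω).S)
            (phaseSamples (F ω).phase ++
              queried H ω k i j (F ω).S (phaseSamples (F ω).phase)) = ∅} := by
          convert (hF.S.list_append (hF.T.list_append hq))
            (measurableSet_versionSpace_nonempty (hU k) (hH k)).compl using 1
          ext ω
          simp only [Set.mem_preimage, Set.mem_compl_iff, Set.mem_ofPred_eq,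
            Set.not_nonempty_iff_eq_empty, versionSpace_versionSpace]
        exact (MeasurableSet.const _).union hempty
      · exact ⟨hF.S.list_append (hF.T.list_append hq), measurable_const, hF.k, hF.l,
          measurable_const, measurable_const⟩
      · exact ⟨hF.S, hF.T.list_append hq, hF.k, hF.l, hF.iter, measurable_const⟩
    · intro ω hω
      simp only [Prod.mk.injEq] at hω
      obtain ⟨rfl, rfl, rfl, hτ⟩ := hω
      obtain ⟨T, hp⟩ : ∃ T, (F ω).phase = Phase.cal j T := by
        cases h : (F ω).phase with
        | search => simp [h, phaseTag] at hτ
        | halted => simp [h, phaseTag] at hτ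
        | cal j' T => simp [h, phaseTag] at hτ; exact ⟨T, by rw [hτ]⟩
      rw [step_of_phase_cal _ _ _ _ _ hp, calStep_eq]
      simp only [hp, phaseSamples]

theorem measurableConfig_run (hU : ∀ k, CountablyApproximates (U k) (H k))
    (hH : ∀ k, ∀ h ∈ H k, Measurable h) (hs : MeasurableOracle search) (z₀ : X × Bool) (t : ℕ) :
    MeasurableConfig fun ω => run H d search ε δ ω t := by
  induction t with
  | zero =>
    exact ⟨measurable_const, measurable_const, measurable_const, measurable_const,
      measurable_const, measurable_const⟩
  | succ t ih => exact MeasurableConfig.step hU hH hs z₀ ih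

end Runs

/-! ### Passing strict probability bounds to approximants. -/

section Approximation

variable {Z : Type*} [MeasurableSpace Z]

/-- Pointwise convergence of indicators gives convergence of the probabilities, and a strict lower
bound is an open condition. -/
theorem eventually_lt_measureReal (P : Measure Z) [IsProbabilityMeasure P] {a : Z → Bool}
    {b : ℕ → Z → Bool} (hb : ∀ n, Measurable (b n)) (hlim : ∀ z, ∀ᶠ n in atTop, b n z = a z)
    {r : ℝ} (hr : r < P.real {z | a z = true}) : ∀ᶠ n in atTop, r < P.real {z | b n z = true} := by
  have h := tendsto_measure_of_tendsto_indicator_of_isFiniteMeasure atTop (μ := P)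
    (As := fun n => {z | b n z = true}) (A := {z | a z = true})
    (fun n => hb n (measurableSet_singleton true)) (fun z => by
      filter_upwards [hlim z] with n hn
      simp only [hn])
  have h' := (ENNReal.tendsto_toReal (measure_ne_top P _)).comp h
  exact h'.eventually (lt_mem_nhds hr)

end Approximation

/-! ### The good event and its probability. -/

section GoodEvent

variable {X : Type*} [MeasurableSpace X]

/-- The deviation bounds for batch `j` of iteration `i`, when it is started in configuration
`s`. -/
structure GoodBatch (D : Measure (X × Bool)) (H : ℕ → Set (X → Bool)) (d : ℕ → ℕ)
    (hstar : X → Bool) (δ : ℝ) (ω : ℕ × ℕ × ℕ → X × Bool) (i j : ℕ) (s : Config X) : Prop where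
  error_le : ∀ h ∈ H s.k, (∀ p < 2 ^ j, h (ω (i, j, p)).1 = hstar (ω (i, j, p)).1) →
    D.real {z | h z.1 ≠ hstar z.1} ≤ phi (d s.k) (2 ^ j) (batchDelta δ i j / 2)
  difference_le : ∀ h ∈ H s.k, ∀ h' ∈ H s.k,
    (∀ p < 2 ^ j, h (ω (i, j, p)).1 = h' (ω (i, j, p)).1) →
    D.real {z | h z.1 ≠ h' z.1} ≤ 2 * phi (d s.k) (2 ^ j) (batchDelta δ i j / 2)
  length_le : ((queried H ω s.k i j s.S (phaseSamples s.phase)).length : ℝ) ≤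
    2 * (2 ^ j * D.real {z | z.1 ∈ disagreement
      (versionSpace (versionSpace (H s.k) s.S) (phaseSamples s.phase))} +
      Real.log (4 / batchDelta δ i j))

/-- Some function in `𝒜` vanishes on batch `j` of iteration `i` but has a large mean. -/
def MissedOn (D : Measure (X × Bool)) (𝒜 : Set (X × Bool → Bool)) (i j : ℕ) (r : ℝ)
    (ω : ℕ × ℕ × ℕ → X × Bool) : Prop :=
  ∃ a ∈ 𝒜, r < D.real {z | a z = true} ∧ ∀ g : Fin (2 ^ j), a (ω (i, j, g)) = false

theorem measurableSet_missedOn (D : Measure (X × Bool)) {𝒜 : Set (X × Bool → Bool)}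
    (hc : 𝒜.Countable) (hm : ∀ a ∈ 𝒜, Measurable a) (i j : ℕ) (r : ℝ) :
    MeasurableSet {ω | MissedOn D 𝒜 i j r ω} := by
  have : {ω : ℕ × ℕ × ℕ → X × Bool | MissedOn D 𝒜 i j r ω} =
      ⋃ a ∈ 𝒜, {_ω | r < D.real {z | a z = true}} ∩
        ⋂ g : Fin (2 ^ j), {ω | a (ω (i, j, g)) = false} := by
    ext ω
    simp only [MissedOn, Set.mem_ofPred_eq, Set.mem_iUnion, Set.mem_inter_iff, Set.mem_iInter,
      exists_prop]
  rw [this]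
  refine MeasurableSet.biUnion hc fun a ha => (MeasurableSet.const _).inter ?_
  exact MeasurableSet.iInter fun g =>
    (measurable_pi_apply (X := fun _ => X × Bool) (i, j, (g : ℕ)))
      (hm a ha (measurableSet_singleton false))

/-- The indicators of the errors of the members of `V` as predictors of `f`. -/
def errorClass {X : Type*} (V : Set (X → Bool)) (f : X → Bool) : Set (X × Bool → Bool) :=
  {a | ∃ h ∈ V, a = fun z => h z.1 != f z.1}

/-- The indicators of the differences of two members of `V`. -/
def differenceClass {X : Type*} (V : Set (X → Bool)) : Set (X × Bool → Bool) :=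
  {a | ∃ h ∈ V, ∃ h' ∈ V, a = fun z => h z.1 != h' z.1}

theorem errorClass_countable {X : Type*} {V : Set (X → Bool)} (hV : V.Countable) (f : X → Bool) :
    (errorClass V f).Countable := by
  have : errorClass V f = (fun h (z : X × Bool) => h z.1 != f z.1) '' V := by
    ext a; simp [errorClass, eq_comm]
  rw [this]; exact hV.image _

theorem differenceClass_countable {X : Type*} {V : Set (X → Bool)} (hV : V.Countable) :
    (differenceClass V).Countable := by
  have : differenceClass V =
      (fun q : (X → Bool) × (X → Bool) => fun z : X × Bool => q.1 z.1 != q.2 z.1) '' (V ×ˢ V) := by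
    ext a
    constructor
    · rintro ⟨h, hh, h', hh', rfl⟩; exact ⟨(h, h'), ⟨hh, hh'⟩, rfl⟩
    · rintro ⟨⟨h, h'⟩, ⟨hh, hh'⟩, rfl⟩; exact ⟨h, hh, h', hh', rfl⟩
  rw [this]; exact (hV.prod hV).image _

theorem measurable_bne {h f : X → Bool} (hh : Measurable h) (hf : Measurable f) :
    Measurable fun z : X × Bool => h z.1 != f z.1 := by
  have : Measurable fun q : Bool × Bool => q.1 != q.2 := Measurable.of_discrete
  exact this.comp ((hh.comp measurable_fst).prodMk (hf.comp measurable_fst))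

theorem batch_injective (i j : ℕ) :
    Function.Injective fun g : Fin (2 ^ j) => (i, j, (g : ℕ)) := by
  intro a b h
  simp only [Prod.mk.injEq, true_and] at h
  exact Fin.ext h

variable {D : Measure (X × Bool)} [IsProbabilityMeasure D] {H U : ℕ → Set (X → Bool)} {d : ℕ → ℕ}
  {search : ℕ → List (X × Bool) → Option (X × Bool)} {ε δ : ℝ} {hstar : X → Bool}

theorem batchDelta_pos (hδ : 0 < δ) {i j : ℕ} (hi : 1 ≤ i) (hj : 1 ≤ j) :
    0 < batchDelta δ i j := by
  have : (1 : ℝ) ≤ i := by exact_mod_cast hi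
  have : (1 : ℝ) ≤ j := by exact_mod_cast hj
  unfold batchDelta; positivity

theorem batchDelta_le (hδ : 0 < δ) (hδ1 : δ < 1) {i j : ℕ} (hi : 1 ≤ i) (hj : 1 ≤ j) :
    batchDelta δ i j ≤ 1 := by
  have hi' : (1 : ℝ) ≤ i := by exact_mod_cast hi
  have hj' : (1 : ℝ) ≤ j := by exact_mod_cast hj
  unfold batchDelta
  rw [div_div, div_le_one (by positivity)]
  have h1 : (1 : ℝ) ≤ (i : ℝ) ^ 2 + i := by nlinarith
  have h2 : (1 : ℝ) ≤ (j : ℝ) * (j + 1) := by nlinarith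
  nlinarith

/-- A violating hypothesis, or pair, of `H` can be replaced by approximants from the countable
class: they eventually agree with it on the finite batch, and their probabilities still exceed the
threshold. -/
theorem goodBatch_of_not_missed (hU : ∀ k, CountablyApproximates (U k) (H k))
    (hH : ∀ k, ∀ h ∈ H k, Measurable h) (hstar_meas : Measurable hstar)
    {ω : ℕ × ℕ × ℕ → X × Bool} {i j : ℕ} {s : Config X}
    (hA : ¬ MissedOn D (errorClass (U s.k) hstar) i j
      ((1 : ℕ) * phi (d s.k) (2 ^ j) (batchDelta δ i j / 2)) ω)
    (hB : ¬ MissedOn D (differenceClass (U s.k)) i j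
      ((2 : ℕ) * phi (d s.k) (2 ^ j) (batchDelta δ i j / 2)) ω)
    (hC : ((queried H ω s.k i j s.S (phaseSamples s.phase)).length : ℝ) ≤
      2 * (2 ^ j * D.real {z | z.1 ∈ disagreement
        (versionSpace (versionSpace (H s.k) s.S) (phaseSamples s.phase))} +
        Real.log (4 / batchDelta δ i j))) :
    GoodBatch D H d hstar δ ω i j s := by
  have hset : ∀ h f : X → Bool, {z : X × Bool | h z.1 ≠ f z.1} =
      {z | (h z.1 != f z.1) = true} := by
    intro h f; ext z; simp
  refine ⟨fun h hh hag => ?_, fun h hh h' hh' hag => ?_, hC⟩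
  · by_contra hlt
    rw [not_le, hset] at hlt
    obtain ⟨g, hg, hgh⟩ := (hU s.k).2.2 h hh
    have h1 := eventually_lt_measureReal D (a := fun z => h z.1 != hstar z.1)
      (b := fun n z => g n z.1 != hstar z.1)
      (fun n => measurable_bne (hH _ _ ((hU s.k).1 (hg n))) hstar_meas)
      (fun z => by filter_upwards [hgh z.1] with n hn; rw [hn]) hlt
    have h2 := eventually_forall_mem hgh (fun p => (ω (i, j, p)).1) (List.range (2 ^ j))
    obtain ⟨n, hn1, hn2⟩ := (h1.and h2).exists
    refine hA ⟨_, ⟨g n, hg n, rfl⟩, by simpa using hn1, fun p => ?_⟩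
    simp [hn2 p (by simp), hag p p.2]
  · by_contra hlt
    rw [not_le, hset] at hlt
    obtain ⟨g, hg, hgh⟩ := (hU s.k).2.2 h hh
    obtain ⟨g', hg', hgh'⟩ := (hU s.k).2.2 h' hh'
    have h1 := eventually_lt_measureReal D (a := fun z => h z.1 != h' z.1)
      (b := fun n z => g n z.1 != g' n z.1)
      (fun n => measurable_bne (hH _ _ ((hU s.k).1 (hg n))) (hH _ _ ((hU s.k).1 (hg' n))))
      (fun z => by filter_upwards [hgh z.1, hgh' z.1] with n hn hn'; rw [hn, hn']) hlt
    have h2 := eventually_forall_mem hgh (fun p => (ω (i, j, p)).1) (List.range (2 ^ j))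
    have h3 := eventually_forall_mem hgh' (fun p => (ω (i, j, p)).1) (List.range (2 ^ j))
    obtain ⟨n, ⟨hn1, hn2⟩, hn3⟩ := ((h1.and h2).and h3).exists
    refine hB ⟨_, ⟨g n, hg n, g' n, hg' n, rfl⟩, by simpa using hn1, fun p => ?_⟩
    simp [hn2 p (by simp), hn3 p (by simp), hag p p.2]

theorem measurableSet_atBatch_and (hU : ∀ k, CountablyApproximates (U k) (H k))
    (hH : ∀ k, ∀ h ∈ H k, Measurable h) (hs : MeasurableOracle search) (z₀ : X × Bool)
    (i j t : ℕ) {Bad : ℕ → Set (ℕ × ℕ × ℕ → X × Bool)} (hBad : ∀ k, MeasurableSet (Bad k)) :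
    MeasurableSet {ω | AtBatch i j (run H d search ε δ ω t) ∧
      ω ∈ Bad (run H d search ε δ ω t).k} := by
  have hF := measurableConfig_run (d := d) (ε := ε) (δ := δ) hU hH hs z₀ t
  have : {ω | AtBatch i j (run H d search ε δ ω t) ∧ ω ∈ Bad (run H d search ε δ ω t).k} =
      ({ω | (run H d search ε δ ω t).iter = i} ∩
        {ω | phaseTag (run H d search ε δ ω t).phase = j + 2}) ∩
      ⋃ k, {ω | (run H d search ε δ ω t).k = k} ∩ Bad k := by
    ext ω
    have h1 : AtBatch i j (run H d search ε δ ω t) ↔ (run H d search ε δ ω t).iter = i ∧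
        phaseTag (run H d search ε δ ω t).phase = j + 2 := by
      refine and_congr_right fun _ => ?_
      cases (run H d search ε δ ω t).phase <;> simp [phaseTag]
    simp only [Set.mem_ofPred_eq, Set.mem_inter_iff, Set.mem_iUnion, h1]
    refine and_congr_right fun _ => ?_
    constructor
    · intro h; exact ⟨_, rfl, h⟩
    · rintro ⟨k, rfl, h⟩; exact h
  rw [this]
  refine ((hF.iter (measurableSet_singleton i)).inter
    (hF.tag (measurableSet_singleton (j + 2)))).inter ?_
  exact MeasurableSet.iUnion fun k => (hF.k (measurableSet_singleton k)).inter (hBad k)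

theorem nonempty_of_isProbabilityMeasure (D : Measure (X × Bool)) [IsProbabilityMeasure D] :
    Nonempty (X × Bool) := by
  by_contra h
  rw [not_nonempty_iff] at h
  have := measure_univ (μ := D)
  simp [Set.univ_eq_empty_iff.2 h] at this

/-- For each batch, all deviation bounds hold outside a set of probability `batchDelta δ i j`. -/
theorem infinitePi_not_goodBatch_le (hU : ∀ k, CountablyApproximates (U k) (H k))
    (hH : ∀ k, ∀ h ∈ H k, Measurable h) (hd : ∀ k, vcDim (H k) = d k)
    (hstar_meas : Measurable hstar) (hs : MeasurableOracle search) (hδ : 0 < δ) (hδ1 : δ < 1)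
    {i j : ℕ} (hi : 1 ≤ i) (hj : 1 ≤ j) :
    (Measure.infinitePi fun _ : ℕ × ℕ × ℕ => D)
      {ω | ∃ t, AtBatch i j (run H d search ε δ ω t) ∧
        ¬ GoodBatch D H d hstar δ ω i j (run H d search ε δ ω t)} ≤
      ENNReal.ofReal (batchDelta δ i j) := by
  classical
  obtain ⟨z₀⟩ := nonempty_of_isProbabilityMeasure D
  set η := batchDelta δ i j with hη
  have hη0 : 0 < η := batchDelta_pos hδ hi hj
  have hη1 : η ≤ 1 := batchDelta_le hδ hδ1 hi hj
  have h2j : 2 ≤ 2 ^ j := by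
    calc 2 = 2 ^ 1 := rfl
      _ ≤ 2 ^ j := Nat.pow_le_pow_right (by norm_num) hj
  have hUd : ∀ k, vcDim (U k) ≤ d k := fun k => (vcDim_mono (hU k).1).trans (hd k).le
  have hUm : ∀ k, ∀ h ∈ U k, Measurable h := fun k h hh => hH k h ((hU k).1 hh)
  have hmE : ∀ k, ∀ a ∈ errorClass (U k) hstar, Measurable a := by
    rintro k _ ⟨h, hh, rfl⟩; exact measurable_bne (hUm k h hh) hstar_meas
  have hmD : ∀ k, ∀ a ∈ differenceClass (U k), Measurable a := by
    rintro k _ ⟨h, hh, h', hh', rfl⟩; exact measurable_bne (hUm k h hh) (hUm k h' hh')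
  let μ := Measure.infinitePi fun _ : ℕ × ℕ × ℕ => D
  let BA (s : Config X) (ω : ℕ × ℕ × ℕ → X × Bool) : Prop :=
    MissedOn D (errorClass (U s.k) hstar) i j ((1 : ℕ) * phi (d s.k) (2 ^ j) (η / 2)) ω
  let BB (s : Config X) (ω : ℕ × ℕ × ℕ → X × Bool) : Prop :=
    MissedOn D (differenceClass (U s.k)) i j ((2 : ℕ) * phi (d s.k) (2 ^ j) (η / 2)) ω
  let BC (s : Config X) (ω : ℕ × ℕ × ℕ → X × Bool) : Prop :=
    2 * (2 ^ j * D.real {z | z.1 ∈ disagreement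
      (versionSpace (versionSpace (H s.k) s.S) (phaseSamples s.phase))} + Real.log (4 / η)) <
      ((queried H ω s.k i j s.S (phaseSamples s.phase)).length : ℝ)
  have hbatch : ∀ ω ω' : ℕ × ℕ × ℕ → X × Bool, (∀ p, ω (i, j, p) = ω' (i, j, p)) →
      batch ω i j = batch ω' i j := fun ω ω' h => List.map_congr_left fun p _ => h p
  -- The budget η is split as η/2 + η/4 + η/4. With confidence η/2 in `missed_event_le`, errors (r =
  -- 1) cost 2(η/4) = η/2 and differences (r = 2) cost 2(η/4)² ≤ η/4; the query count is given η/4.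
  have hA : μ {ω | ∃ t, AtBatch i j (run H d search ε δ ω t) ∧
      BA (run H d search ε δ ω t) ω} ≤ ENNReal.ofReal (η / 2) := by
    refine infinitePi_atBatch_le D i j BA ?_ ?_ ?_
    · rintro s ω ω' h ⟨a, ha, hr, hg⟩
      exact ⟨a, ha, hr, fun g => by rw [← h]; exact hg g⟩
    · intro s _
      have := missed_event_le D (errorClass (U s.k) hstar)
        (errorClass_countable (hU s.k).2.1 _) (hmE s.k) h2j (d := d s.k) (r := 1)
        (fun x => ncard_error_patterns_le (hUd s.k) hstar Prod.fst x)
        (δ := η / 2) (by positivity) (by linarith) (batch_injective i j)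
      refine this.trans (ENNReal.ofReal_le_ofReal ?_)
      linarith
    · intro t
      exact measurableSet_atBatch_and hU hH hs z₀ i j t fun k =>
        measurableSet_missedOn D (errorClass_countable (hU k).2.1 hstar) (hmE k) i j
          ((1 : ℕ) * phi (d k) (2 ^ j) (η / 2))
  have hB : μ {ω | ∃ t, AtBatch i j (run H d search ε δ ω t) ∧
      BB (run H d search ε δ ω t) ω} ≤ ENNReal.ofReal (η / 4) := by
    refine infinitePi_atBatch_le D i j BB ?_ ?_ ?_
    · rintro s ω ω' h ⟨a, ha, hr, hg⟩
      exact ⟨a, ha, hr, fun g => by rw [← h]; exact hg g⟩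
    · intro s _
      have := missed_event_le D (differenceClass (U s.k))
        (differenceClass_countable (hU s.k).2.1) (hmD s.k) h2j (d := d s.k) (r := 2)
        (fun x => ncard_difference_patterns_le (hUd s.k) Prod.fst x)
        (δ := η / 2) (by positivity) (by linarith) (batch_injective i j)
      refine this.trans (ENNReal.ofReal_le_ofReal ?_)
      nlinarith
    · intro t
      exact measurableSet_atBatch_and hU hH hs z₀ i j t fun k =>
        measurableSet_missedOn D (differenceClass_countable (hU k).2.1) (hmD k) i j
          ((2 : ℕ) * phi (d k) (2 ^ j) (η / 2))
  have hC : μ {ω | ∃ t, AtBatch i j (run H d search ε δ ω t) ∧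
      BC (run H d search ε δ ω t) ω} ≤ ENNReal.ofReal (η / 4) := by
    refine infinitePi_atBatch_le D i j BC ?_ ?_ ?_
    · intro s ω ω' h hb
      simpa only [BC, queried, hbatch ω ω' h] using hb
    · intro s _
      have hDis : MeasurableSet {z : X × Bool | z.1 ∈ disagreement
          (versionSpace (versionSpace (H s.k) s.S) (phaseSamples s.phase))} :=
        measurableSet_mem_disagreement_comp hU hH s.k (measurable_const (a := s.S))
          (measurable_const (a := phaseSamples s.phase)) measurable_fst
      have := count_gt_le D hDis (batch_injective i j) (δ := η / 4) (by positivity)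
        (by linarith) (fun ω => (queried H ω s.k i j s.S (phaseSamples s.phase)).length)
        (fun ω => ⟨Finset.univ.filter fun g => (ω (i, j, (g : ℕ))).1 ∈ disagreement
          (versionSpace (versionSpace (H s.k) s.S) (phaseSamples s.phase)), by simp, by
            have := length_filter_map_range (2 ^ j) (fun p => ω (i, j, p)) (fun p =>
              decide (p.1 ∈ disagreement
                (versionSpace (versionSpace (H s.k) s.S) (phaseSamples s.phase))))
            simp only [decide_eq_true_eq] at this
            exact this⟩)
      convert this using 4
      push_cast
      rw [one_div_div]
    · intro t
      have hF := measurableConfig_run (d := d) (ε := ε) (δ := δ) hU hH hs z₀ t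
      have hp : ∀ k, Measurable fun ω => D.real {z | z.1 ∈ disagreement (versionSpace
          (versionSpace (H k) (run H d search ε δ ω t).S)
            (phaseSamples (run H d search ε δ ω t).phase))} := by
        intro k
        have hm := measurableSet_mem_disagreement_comp hU hH k
          (S := fun q : (ℕ × ℕ × ℕ → X × Bool) × (X × Bool) => (run H d search ε δ q.1 t).S)
          (T := fun q => phaseSamples (run H d search ε δ q.1 t).phase) (x := fun q => q.2.1)
          (hF.S.comp measurable_fst) (hF.T.comp measurable_fst)
          (measurable_fst.comp measurable_snd)
        exact (measurable_measure_prodMk_left (ν := D) hm).ennreal_toReal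
      have hq : ∀ k, Measurable fun ω => ((queried H ω k i j (run H d search ε δ ω t).S
          (phaseSamples (run H d search ε δ ω t).phase)).length : ℝ) := fun k =>
        (measurable_from_nat (f := fun n : ℕ => (n : ℝ))).comp
          (measurable_list_length.comp (measurable_queried hU hH k i j hF.S hF.T))
      exact measurableSet_atBatch_and hU hH hs z₀ i j t
        (Bad := fun k => {ω | 2 * (2 ^ j * D.real {z | z.1 ∈ disagreement (versionSpace
          (versionSpace (H k) (run H d search ε δ ω t).S)
            (phaseSamples (run H d search ε δ ω t).phase))} + Real.log (4 / η)) <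
            ((queried H ω k i j (run H d search ε δ ω t).S
          (phaseSamples (run H d search ε δ ω t).phase)).length : ℝ)})
        fun k => measurableSet_lt ((((hp k).const_mul _).add_const _).const_mul _) (hq k)
  have hsub : {ω | ∃ t, AtBatch i j (run H d search ε δ ω t) ∧
        ¬ GoodBatch D H d hstar δ ω i j (run H d search ε δ ω t)} ⊆
      {ω | ∃ t, AtBatch i j (run H d search ε δ ω t) ∧ BA (run H d search ε δ ω t) ω} ∪
      ({ω | ∃ t, AtBatch i j (run H d search ε δ ω t) ∧ BB (run H d search ε δ ω t) ω} ∪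
      {ω | ∃ t, AtBatch i j (run H d search ε δ ω t) ∧ BC (run H d search ε δ ω t) ω}) := by
    rintro ω ⟨t, hat, hng⟩
    by_contra hno
    simp only [Set.mem_union, Set.mem_ofPred_eq, not_or, not_exists, not_and] at hno
    exact hng (goodBatch_of_not_missed hU hH hstar_meas (hno.1 t hat) (hno.2.1 t hat)
      (not_lt.1 (hno.2.2 t hat)))
  calc _ ≤ _ := measure_mono hsub
    _ ≤ _ + (_ + _) := (measure_union_le _ _).trans (add_le_add le_rfl (measure_union_le _ _))
    _ ≤ ENNReal.ofReal (η / 2) + (ENNReal.ofReal (η / 4) + ENNReal.ofReal (η / 4)) :=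
      add_le_add hA (add_le_add hB hC)
    _ = ENNReal.ofReal η := by
      rw [← ENNReal.ofReal_add (by positivity) (by positivity),
        ← ENNReal.ofReal_add (by positivity) (by positivity)]
      congr 1; ring

/-- A telescoping series, needed once for the batches of a call and once for the iterations. -/
theorem tsum_ofReal_mul_inv_le {a : ℝ} (ha : 0 ≤ a) :
    ∑' n : ℕ, ENNReal.ofReal (a / (((n + 1 : ℕ) : ℝ) * ((n + 1 : ℕ) + 1))) ≤
      ENNReal.ofReal a := by
  have hsum : ∀ n : ℕ, ∑ k ∈ Finset.range n, a / (((k + 1 : ℕ) : ℝ) * ((k + 1 : ℕ) + 1)) =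
      a * (1 - 1 / (n + 1)) := by
    intro n
    induction n with
    | zero => simp
    | succ n ih =>
      rw [Finset.sum_range_succ, ih]
      push_cast
      field_simp
      ring
  refine ENNReal.tsum_le_of_sum_range_le fun n => ?_
  rw [← ENNReal.ofReal_sum_of_nonneg fun k _ => by positivity, hsum]
  apply ENNReal.ofReal_le_ofReal
  have : (0 : ℝ) ≤ 1 / (n + 1) := by positivity
  nlinarith

/-- All labels are those of `hstar`, and all batches of the run satisfy the deviation bounds. -/
def GoodSample (D : Measure (X × Bool)) (H : ℕ → Set (X → Bool)) (d : ℕ → ℕ)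
    (search : ℕ → List (X × Bool) → Option (X × Bool)) (ε δ : ℝ) (hstar : X → Bool)
    (ω : ℕ × ℕ × ℕ → X × Bool) : Prop :=
  (∀ q, (ω q).2 = hstar (ω q).1) ∧ ∀ i j t, 1 ≤ i → 1 ≤ j →
    AtBatch i j (run H d search ε δ ω t) →
      GoodBatch D H d hstar δ ω i j (run H d search ε δ ω t)

theorem infinitePi_not_goodSample_le (hsep : ∀ k, PointwiseSeparable (H k))
    (hH : ∀ k, ∀ h ∈ H k, Measurable h) (hd : ∀ k, vcDim (H k) = d k)
    (hstar_meas : Measurable hstar) (herr : err D hstar = 0) (hs : MeasurableOracle search)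
    (hδ : 0 < δ) (hδ1 : δ < 1) :
    (Measure.infinitePi fun _ : ℕ × ℕ × ℕ => D)
      {ω | ¬ GoodSample D H d search ε δ hstar ω} ≤ ENNReal.ofReal δ := by
  choose U hU using hsep
  have hU' : ∀ k, CountablyApproximates (U k) (H k) := hU
  set μ := Measure.infinitePi fun _ : ℕ × ℕ × ℕ => D
  have hnull : μ (⋃ q, {ω | hstar (ω q).1 ≠ (ω q).2}) = 0 := by
    refine measure_iUnion_null fun q => ?_
    have hm : MeasurableSet {z : X × Bool | hstar z.1 ≠ z.2} :=
      (measurableSet_eq_fun (hstar_meas.comp measurable_fst) measurable_snd).compl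
    have h0 : D {z : X × Bool | hstar z.1 ≠ z.2} = 0 := by
      rw [err, Measure.real, ENNReal.toReal_eq_zero_iff] at herr
      exact herr.resolve_right (measure_ne_top _ _)
    rw [← Measure.infinitePi_map_eval (fun _ : ℕ × ℕ × ℕ => D) q,
      Measure.map_apply (measurable_pi_apply q) hm] at h0
    exact h0
  have hsub : {ω | ¬ GoodSample D H d search ε δ hstar ω} ⊆
      (⋃ q, {ω | hstar (ω q).1 ≠ (ω q).2}) ∪ ⋃ i : ℕ, ⋃ j : ℕ,
        {ω | ∃ t, AtBatch (i + 1) (j + 1) (run H d search ε δ ω t) ∧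
          ¬ GoodBatch D H d hstar δ ω (i + 1) (j + 1) (run H d search ε δ ω t)} := by
    intro ω hω
    by_contra hno
    simp only [Set.mem_union, Set.mem_iUnion, Set.mem_ofPred_eq, not_or, not_exists, not_and,
      not_not] at hno
    refine hω ⟨fun q => (hno.1 q).symm, fun i j t hi hj hat => ?_⟩
    obtain ⟨i, rfl⟩ := Nat.exists_eq_add_of_le' hi
    obtain ⟨j, rfl⟩ := Nat.exists_eq_add_of_le' hj
    exact hno.2 i j t hat
  have hbound : μ (⋃ i : ℕ, ⋃ j : ℕ,
        {ω | ∃ t, AtBatch (i + 1) (j + 1) (run H d search ε δ ω t) ∧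
          ¬ GoodBatch D H d hstar δ ω (i + 1) (j + 1) (run H d search ε δ ω t)}) ≤
      ENNReal.ofReal δ := by
    calc _ ≤ ∑' i : ℕ, ∑' j : ℕ, ENNReal.ofReal (batchDelta δ (i + 1) (j + 1)) :=
          (measure_iUnion_le _).trans (ENNReal.tsum_le_tsum fun i =>
            (measure_iUnion_le _).trans (ENNReal.tsum_le_tsum fun j =>
              infinitePi_not_goodBatch_le hU' hH hd hstar_meas hs hδ hδ1 (by omega) (by omega)))
      _ ≤ ∑' i : ℕ, ENNReal.ofReal (δ / (((i + 1 : ℕ) : ℝ) * ((i + 1 : ℕ) + 1))) := by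
          refine ENNReal.tsum_le_tsum fun i => ?_
          have : δ / (((i + 1 : ℕ) : ℝ) * ((i + 1 : ℕ) + 1)) =
              δ / (((i + 1 : ℕ) : ℝ) ^ 2 + (i + 1 : ℕ)) := by congr 1; ring
          rw [this]
          exact tsum_ofReal_mul_inv_le (by positivity)
      _ ≤ ENNReal.ofReal δ := tsum_ofReal_mul_inv_le hδ.le
  calc _ ≤ _ := measure_mono hsub
    _ ≤ _ + _ := measure_union_le _ _
    _ ≤ ENNReal.ofReal δ := by rw [hnull, zero_add]; exact hbound

end GoodEvent

/-! ### Deterministic analysis: the realizable setting and version spaces along a run. -/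

variable {X : Type*} [MeasurableSpace X]

/-- The assumptions on the classes, the distribution, the oracle and the parameters. -/
structure Realizable (D : Measure (X × Bool)) (H : ℕ → Set (X → Bool)) (kstar : ℕ)
    (hstar : X → Bool) (search : ℕ → List (X × Bool) → Option (X × Bool)) (ε δ : ℝ) : Prop where
  mono : Monotone H
  meas : ∀ k, ∀ h ∈ H k, Measurable h
  sep : ∀ k, PointwiseSeparable (H k)
  mem : hstar ∈ H kstar
  err_eq : err D hstar = 0
  oracle : IsSearchOracle H hstar search
  eps_pos : 0 < ε
  eps_lt : ε < 1
  delta_pos : 0 < δ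
  delta_lt : δ < 1

section VersionSpaces

theorem versionSpace_anti {X : Type*} (V : Set (X → Bool)) {S S' : List (X × Bool)}
    (h : ∀ p ∈ S, p ∈ S') : versionSpace V S' ⊆ versionSpace V S :=
  fun _ hf => ⟨hf.1, fun p hp => hf.2 p (h p hp)⟩

theorem versionSpace_mono {X : Type*} {V W : Set (X → Bool)} (h : V ⊆ W) (S : List (X × Bool)) :
    versionSpace V S ⊆ versionSpace W S := fun _ hf => ⟨h hf.1, hf.2⟩

theorem disagreement_mono {X : Type*} {V W : Set (X → Bool)} (h : V ⊆ W) :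
    disagreement V ⊆ disagreement W := by
  rintro x ⟨f, hf, g, hg, hne⟩
  exact ⟨f, h hf, g, h hg, hne⟩

/-- Two functions in the version space after a batch agree on the whole batch, and they agree
there with the truth outside the region of disagreement if one of them does. -/
theorem eq_on_batch {X : Type*} {H : ℕ → Set (X → Bool)} {ω : ℕ × ℕ × ℕ → X × Bool} {k i j : ℕ}
    {S T : List (X × Bool)} {f g : X → Bool}
    (hf : f ∈ versionSpace (versionSpace (H k) S) (T ++ queried H ω k i j S T))
    (hg : g ∈ versionSpace (versionSpace (H k) S) T) {p : ℕ} (hp : p < 2 ^ j) :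
    f (ω (i, j, p)).1 = (ω (i, j, p)).2 ∨ f (ω (i, j, p)).1 = g (ω (i, j, p)).1 := by
  classical
  by_cases hx : (ω (i, j, p)).1 ∈ disagreement (versionSpace (versionSpace (H k) S) T)
  · left
    refine hf.2 _ (List.mem_append_right _ ?_)
    refine List.mem_filter.2 ⟨List.mem_map.2 ⟨p, List.mem_range.2 hp, rfl⟩, ?_⟩
    simpa using hx
  · right
    by_contra hne
    exact hx ⟨f, versionSpace_anti _ (fun q hq => List.mem_append_left _ hq) hf, g, hg, hne⟩

theorem mem_queried {X : Type*} {H : ℕ → Set (X → Bool)} {ω : ℕ × ℕ × ℕ → X × Bool} {k i j : ℕ}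
    {S T : List (X × Bool)} {p : X × Bool} (hp : p ∈ queried H ω k i j S T) : ∃ q, p = ω q := by
  obtain ⟨n, _, rfl⟩ := List.mem_map.1 (List.mem_filter.1 hp).1
  exact ⟨_, rfl⟩

theorem run_S_subset {X : Type*} {H : ℕ → Set (X → Bool)} {d : ℕ → ℕ}
    {search : ℕ → List (X × Bool) → Option (X × Bool)} {ε δ : ℝ} {ω : ℕ × ℕ × ℕ → X × Bool}
    {t t' : ℕ} (h : t ≤ t') {p : X × Bool} (hp : p ∈ (run H d search ε δ ω t).S) :
    p ∈ (run H d search ε δ ω t').S := by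
  induction t', h using Nat.le_induction with
  | base => exact hp
  | succ n _ ih =>
    simp only [run]
    cases hph : (run H d search ε δ ω n).phase with
    | search =>
      rw [step_of_phase_search _ _ _ _ _ hph]
      unfold searchStep
      split
      · split_ifs <;> exact ih
      · exact List.mem_append_left _ ih
    | halted => rw [step_of_phase_halted _ _ _ _ _ hph]; exact ih
    | cal j T =>
      rw [step_of_phase_cal _ _ _ _ _ hph, calStep_eq]
      split_ifs
      · exact List.mem_append_left _ ih
      · exact ih

end VersionSpaces

/-! ### From diameter to region of disagreement. -/

section DisagreementCoefficient

/-- Probabilities are at most 1 and radii at least ε, so 1/ε is a bound. Without finiteness,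
`toReal` would return 0 and could not bound anything. -/
theorem maxDisagreementCoeff_ne_top (P : Measure X) [IsProbabilityMeasure P]
    (H : ℕ → Set (X → Bool)) (ρ : ℕ → Config X) (kstar : ℕ) {ε : ℝ} (hε : 0 < ε) :
    maxDisagreementCoeff P H ρ kstar ε ≠ ⊤ := by
  refine ne_top_of_le_ne_top (b := (ENNReal.ofReal ε)⁻¹) (by simpa using hε) ?_
  refine iSup₂_le fun k' _ => iSup₂_le fun t _ => iSup₂_le fun h _ => iSup₂_le fun r hr => ?_
  rw [ENNReal.div_eq_inv_mul]
  calc _ ≤ (ENNReal.ofReal ε)⁻¹ * 1 :=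
        mul_le_mul' (ENNReal.inv_le_inv.2 (ENNReal.ofReal_le_ofReal hr)) prob_le_one
    _ = _ := mul_one _

/-- A subset of the version space of diameter at most `r` has a region of disagreement of
probability at most `θ r`. -/
theorem measureReal_disagreement_le {D : Measure (X × Bool)} [IsProbabilityMeasure D]
    {H : ℕ → Set (X → Bool)} (hH : ∀ k, ∀ h ∈ H k, Measurable h) {ρ : ℕ → Config X}
    (hρ : ∀ t t', t ≤ t' → ∀ p ∈ (ρ t).S, p ∈ (ρ t').S) {kstar t : ℕ} (hk : (ρ t).k ≤ kstar)
    {ε r : ℝ} (hε : 0 < ε) (hr : ε ≤ r) {W : Set (X → Bool)} (hWne : W.Nonempty)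
    (hW : W ⊆ versionSpace (H (ρ t).k) (ρ t).S)
    (hdiam : ∀ h ∈ W, ∀ h' ∈ W, D.real {z | h z.1 ≠ h' z.1} ≤ r) :
    D.real {z | z.1 ∈ disagreement W} ≤
      (maxDisagreementCoeff (D.map Prod.fst) H ρ kstar ε).toReal * r := by
  classical
  have : IsProbabilityMeasure (D.map Prod.fst) :=
    Measure.isProbabilityMeasure_map measurable_fst.aemeasurable
  set P := D.map Prod.fst
  obtain ⟨h₀, hh₀⟩ := hWne
  have hex : ∃ t', (ρ t).k ≤ (ρ t').k := ⟨t, le_rfl⟩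
  -- The coefficient refers to the examples held when the current index was first reached. Examples
  -- are never discarded, so the present version space lies inside that earlier one.
  set t₀ := Nat.find hex
  have ht₀ : IsLeast {t' | (ρ t).k ≤ (ρ t').k} t₀ :=
    ⟨Nat.find_spec hex, fun t' ht' => Nat.find_min' hex ht'⟩
  have htt : t₀ ≤ t := ht₀.2 (show (ρ t).k ≤ (ρ t).k from le_rfl)
  set V := versionSpace (H (ρ t).k) (ρ t₀).S
  have hWV : W ⊆ V := hW.trans (versionSpace_anti _ (hρ _ _ htt))
  have hball : W ⊆ hypothesisBall P V h₀ r := by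
    intro h hh
    refine ⟨hWV hh, ?_⟩
    have hm : MeasurableSet {x | h x ≠ h₀ x} :=
      (measurableSet_eq_fun (hH _ h (hWV hh).1) (hH _ h₀ (hWV hh₀).1)).compl
    rw [Measure.real, Measure.map_apply measurable_fst hm]
    exact hdiam h hh h₀ hh₀
  have hr0 : 0 < r := hε.trans_le hr
  have hcoeff : P (disagreement (hypothesisBall P V h₀ r)) / ENNReal.ofReal r ≤
      maxDisagreementCoeff P H ρ kstar ε := by
    refine le_trans ?_ (le_iSup₂_of_le (ρ t).k hk (le_iSup₂_of_le t₀ ht₀ le_rfl))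
    exact le_iSup₂_of_le h₀ (hWV hh₀) (le_iSup₂_of_le r hr le_rfl)
  have hmain : D {z | z.1 ∈ disagreement W} ≤
      maxDisagreementCoeff P H ρ kstar ε * ENNReal.ofReal r := by
    -- This inequality holds without measurability of the region of disagreement, and `W` is
    -- arbitrary here.
    calc _ ≤ P (disagreement W) := Measure.le_map_apply measurable_fst.aemeasurable _
      _ ≤ P (disagreement (hypothesisBall P V h₀ r)) := measure_mono (disagreement_mono hball)
      _ ≤ _ := by
        rwa [ENNReal.div_le_iff (by simpa using hr0) ENNReal.ofReal_ne_top] at hcoeff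
  have hfin := maxDisagreementCoeff_ne_top P H ρ kstar hε
  calc _ ≤ (maxDisagreementCoeff P H ρ kstar ε * ENNReal.ofReal r).toReal :=
        ENNReal.toReal_mono (ENNReal.mul_ne_top hfin ENNReal.ofReal_ne_top) hmain
    _ = _ := by rw [ENNReal.toReal_mul, ENNReal.toReal_ofReal hr0.le]

theorem err_le_of_err_eq_zero {D : Measure (X × Bool)} [IsProbabilityMeasure D]
    {hstar : X → Bool} (h0 : err D hstar = 0) (h : X → Bool) :
    err D h ≤ D.real {z | h z.1 ≠ hstar z.1} := by
  have hsub : {p : X × Bool | h p.1 ≠ p.2} ⊆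
      {z | h z.1 ≠ hstar z.1} ∪ {p | hstar p.1 ≠ p.2} := by
    intro p hp
    by_cases h1 : h p.1 = hstar p.1
    · exact Or.inr (by rw [Set.mem_ofPred_eq, ← h1]; exact hp)
    · exact Or.inl h1
  calc err D h ≤ D.real ({z | h z.1 ≠ hstar z.1} ∪ {p | hstar p.1 ≠ p.2}) :=
        measureReal_mono hsub
    _ ≤ _ + D.real {p | hstar p.1 ≠ p.2} := measureReal_union_le _ _
    _ = _ := by rw [show D.real {p | hstar p.1 ≠ p.2} = 0 from h0, add_zero]

end DisagreementCoefficient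

/-! ### The run invariant and termination. -/

section Invariant

/-- The largest number of calls of CAL. -/
noncomputable def maxCalls (kstar : ℕ) (ε : ℝ) : ℕ := kstar + ⌈Real.logb 2 (1 / ε)⌉₊

/-- What holds of the control state: `J` bounds the number of batches of a call of CAL and `B`
the number of label queries of a batch. -/
def PhaseInvariant (D : Measure (X × Bool)) (H : ℕ → Set (X → Bool)) (d : ℕ → ℕ)
    (hstar : X → Bool) (ε δ : ℝ) (J : ℕ) (B : ℝ) (s : Config X) : Prop :=
  match s.phase with
  | Phase.search =>
      s.iter ≤ s.k + s.l + 1 ∧ s.searches + 1 = s.iter ∧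
      (s.draws : ℝ) ≤ (s.iter - 1) * 2 ^ (J + 1) ∧ (s.labels : ℝ) ≤ (s.iter - 1) * (J * B) ∧
      -- The premise is what the answer ⊥ of the coming SEARCH query asserts; without it the version
      -- space may be entirely wrong.
      ((∀ x, ∃ h ∈ versionSpace (H s.k) s.S, h x = hstar x) →
        ∀ h ∈ versionSpace (H s.k) s.S, err D h ≤ (2 : ℝ)⁻¹ ^ s.l)
  | Phase.cal j T =>
      s.iter ≤ s.k + s.l ∧ s.searches = s.iter ∧ 1 ≤ j ∧ j ≤ J ∧
      (s.draws : ℝ) ≤ (s.iter - 1) * 2 ^ (J + 1) + 2 ^ j ∧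
      (s.labels : ℝ) ≤ (s.iter - 1) * (J * B) + (j - 1) * B ∧
      (∀ p ∈ T, p.2 = hstar p.1) ∧ (versionSpace (versionSpace (H s.k) s.S) T).Nonempty ∧
      -- Information left by batch j - 1: CAL did not stop there, and the survivors agree on it.
      -- Before the first batch nothing is known.
      (2 ≤ j → (2 : ℝ)⁻¹ ^ s.l ≤ phi (d s.k) (2 ^ (j - 1)) (batchDelta δ s.iter (j - 1) / 2) ∧
        ∀ h ∈ versionSpace (versionSpace (H s.k) s.S) T,
          ∀ h' ∈ versionSpace (versionSpace (H s.k) s.S) T, D.real {z | h z.1 ≠ h' z.1} ≤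
            2 * phi (d s.k) (2 ^ (j - 1)) (batchDelta δ s.iter (j - 1) / 2))
  | Phase.halted =>
      s.iter ≤ s.k + s.l + 1 ∧ s.searches = s.iter ∧
      (s.draws : ℝ) ≤ (s.iter - 1) * 2 ^ (J + 1) ∧ (s.labels : ℝ) ≤ (s.iter - 1) * (J * B) ∧
      (versionSpace (H s.k) s.S).Nonempty ∧ ∀ h ∈ versionSpace (H s.k) s.S, err D h ≤ ε

/-- The invariant of a run on a good sample. -/
structure RunInvariant (D : Measure (X × Bool)) (H : ℕ → Set (X → Bool)) (d : ℕ → ℕ) (kstar : ℕ)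
    (hstar : X → Bool) (ε δ : ℝ) (J : ℕ) (B : ℝ) (s : Config X) : Prop where
  labels_eq : ∀ p ∈ s.S, p.2 = hstar p.1
  iter_pos : 1 ≤ s.iter
  k_le : s.k ≤ kstar
  l_le : s.l ≤ ⌈Real.logb 2 (1 / ε)⌉₊
  eps_le : ε / 2 ≤ (2 : ℝ)⁻¹ ^ s.l
  phase : PhaseInvariant D H d hstar ε δ J B s

variable {D : Measure (X × Bool)} [IsProbabilityMeasure D] {H : ℕ → Set (X → Bool)} {d : ℕ → ℕ}
  {kstar : ℕ} {hstar : X → Bool} {search : ℕ → List (X × Bool) → Option (X × Bool)} {ε δ : ℝ}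
  {J : ℕ} {B : ℝ}

theorem succ_le_ceil_logb {l : ℕ} (hε : 0 < ε) (h : ε < (2 : ℝ)⁻¹ ^ l) :
    l + 1 ≤ ⌈Real.logb 2 (1 / ε)⌉₊ := by
  rw [Nat.succ_le_iff, Nat.lt_ceil, Real.lt_logb_iff_rpow_lt (by norm_num) (by positivity),
    Real.rpow_natCast, lt_div_iff₀ hε]
  rw [inv_pow, lt_inv_comm₀ hε (by positivity), ← one_div] at h
  rw [lt_div_iff₀ hε] at h
  exact h

theorem RunInvariant.init (hε : ε < 1) :
    RunInvariant D H d kstar hstar ε δ J B (initConfig X) := by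
  refine ⟨by simp [initConfig], by simp [initConfig], by simp [initConfig],
    by simp [initConfig], by simp [initConfig]; linarith, ?_⟩
  exact ⟨by simp [initConfig], by simp [initConfig], by simp [initConfig],
    by simp [initConfig], fun _ h _ => by simp [initConfig, err]⟩

theorem RunInvariant.searchStep (R : Realizable D H kstar hstar search ε δ) (hJ : 1 ≤ J)
    {s : Config X} (hs : RunInvariant D H d kstar hstar ε δ J B s)
    (hp : s.phase = Phase.search) :
    RunInvariant D H d kstar hstar ε δ J B (searchStep H search ε s) := by
  have hinv := hs.phase
  simp only [PhaseInvariant, hp] at hinv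
  obtain ⟨hit, hse, hdr, hla, herr⟩ := hinv
  obtain ⟨z₀⟩ := nonempty_of_isProbabilityMeasure D
  have hor := R.oracle s.k s.S
  unfold ActiveLearning.searchStep
  split
  · rename_i hnone
    have hcorrect : ∀ x, ∃ h ∈ versionSpace (H s.k) s.S, h x = hstar x := by
      have := hor.2 hnone
      push Not at this
      exact this
    have hne : (versionSpace (H s.k) s.S).Nonempty :=
      let ⟨h, hh, _⟩ := hcorrect z₀.1
      ⟨h, hh⟩
    split_ifs with hl
    · refine ⟨hs.labels_eq, hs.iter_pos, hs.k_le, hs.l_le, hs.eps_le, ?_⟩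
      exact ⟨hit, hse, hdr, hla, hne, fun h hh => (herr hcorrect h hh).trans hl⟩
    · rw [not_le] at hl
      refine ⟨hs.labels_eq, hs.iter_pos, hs.k_le, succ_le_ceil_logb R.eps_pos hl, ?_, ?_⟩
      -- l increases only when 2^{-l} > ε, so one halving keeps it above ε/2.
      · simp only [pow_succ]; linarith
      · refine ⟨by simp only; omega, hse, le_rfl, hJ, ?_, ?_, by simp, ?_, by simp⟩
        · simp only; linarith
        · simp only; push_cast; linarith
        · simpa [versionSpace] using hne
  · rename_i e hsome
    obtain ⟨he, hmis⟩ := hor.1 e hsome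
    have hlab : ∀ p ∈ s.S ++ [e], p.2 = hstar p.1 := by
      intro p hpm
      rcases List.mem_append.1 hpm with h | h
      · exact hs.labels_eq p h
      · rw [List.mem_singleton.1 h]; exact he
    have hmem : kstar ∈ {k' | (versionSpace (H k') (s.S ++ [e])).Nonempty} :=
      ⟨hstar, R.mem, fun p hpm => (hlab p hpm).symm⟩
    -- Every member of the version space errs on the counterexample, so the current class, and by
    -- nesting each smaller one, has no consistent hypothesis left. The infimum is a true minimum
    -- since `kstar` is in the set.
    have hlt : s.k < sInf {k' | (versionSpace (H k') (s.S ++ [e])).Nonempty} := by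
      by_contra hle
      obtain ⟨h, hh⟩ := Nat.sInf_mem ⟨kstar, hmem⟩
      have hh' := versionSpace_mono (R.mono (not_lt.1 hle)) _ hh
      refine hmis h (versionSpace_anti _ (fun p hp => List.mem_append_left _ hp) hh') ?_
      rw [← he]
      exact hh.2 e (by simp)
    refine ⟨hlab, hs.iter_pos, Nat.sInf_le hmem, hs.l_le, hs.eps_le, ?_⟩
    refine ⟨by simp only; omega, hse, le_rfl, hJ, ?_, ?_, by simp, ?_, by simp⟩
    · simp only; linarith
    · simp only; push_cast; linarith
    · simpa [versionSpace] using Nat.sInf_mem ⟨kstar, hmem⟩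

theorem length_queried_le {X : Type*} {H : ℕ → Set (X → Bool)} (ω : ℕ × ℕ × ℕ → X × Bool) (k i j : ℕ) (S T : List (X × Bool)) :
    (queried H ω k i j S T).length ≤ 2 ^ j := by
  refine (List.length_filter_le _ _).trans ?_
  simp [batch]

theorem RunInvariant.calStep (R : Realizable D H kstar hstar search ε δ)
    {ω : ℕ × ℕ × ℕ → X × Bool} (hω : ∀ q, (ω q).2 = hstar (ω q).1) {s : Config X} {j : ℕ}
    {T : List (X × Bool)} (hs : RunInvariant D H d kstar hstar ε δ J B s)
    (hp : s.phase = Phase.cal j T) (hgood : GoodBatch D H d hstar δ ω s.iter j s)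
    (hJ : phi (d s.k) (2 ^ J) (batchDelta δ s.iter J / 2) ≤ ε / 2)
    (hB : ((queried H ω s.k s.iter j s.S T).length : ℝ) ≤ B) :
    RunInvariant D H d kstar hstar ε δ J B (calStep H d δ ω s j T) := by
  have hinv := hs.phase
  simp only [PhaseInvariant, hp] at hinv
  obtain ⟨hit, hse, hj1, hjJ, hdr, hla, hT, hne, _⟩ := hinv
  have hB0 : 0 ≤ B := (Nat.cast_nonneg _).trans hB
  have hjJ' : (j : ℝ) ≤ J := by exact_mod_cast hjJ
  have hT' : ∀ p ∈ T ++ queried H ω s.k s.iter j s.S T, p.2 = hstar p.1 := by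
    intro p hpm
    rcases List.mem_append.1 hpm with h | h
    · exact hT p h
    · obtain ⟨q, rfl⟩ := mem_queried h; exact hω q
  have hsubT : versionSpace (versionSpace (H s.k) s.S) (T ++ queried H ω s.k s.iter j s.S T) ⊆
      versionSpace (versionSpace (H s.k) s.S) T :=
    versionSpace_anti _ fun q hq => List.mem_append_left _ hq
  rw [calStep_eq]
  split_ifs with hdone
  · refine ⟨?_, by simp, hs.k_le, hs.l_le, hs.eps_le, ?_⟩
    · intro p hpm
      rcases List.mem_append.1 hpm with h | h
      · exact hs.labels_eq p h
      · exact hT' p h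
    · have hpow : (2 : ℝ) ^ j + 2 ^ j ≤ 2 ^ (J + 1) := by
        rw [← two_mul, ← pow_succ']
        exact pow_le_pow_right₀ (by norm_num) (by omega)
      refine ⟨by simp only; omega, by simp only; omega, ?_, ?_, ?_⟩
      · push_cast; linarith
      · push_cast
        have : (j : ℝ) * B ≤ J * B := mul_le_mul_of_nonneg_right hjJ' hB0
        linarith
      · simp only [← versionSpace_versionSpace (H s.k) s.S]
        intro hcorrect h hh
        have hphi : phi (d s.k) (2 ^ j) (batchDelta δ s.iter j / 2) ≤ (2 : ℝ)⁻¹ ^ s.l :=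
          hdone.resolve_right (Set.Nonempty.ne_empty ⟨h, hh⟩)
        refine (err_le_of_err_eq_zero R.err_eq h).trans (le_trans ?_ hphi)
        refine hgood.error_le h hh.1.1 fun p hp2 => ?_
        -- A queried point has the label of `hstar`. On any other point `h` agrees with all members,
        -- in particular with a `g` that is right there; `g` may vary with the point.
        obtain ⟨g, hg, hgx⟩ := hcorrect (ω (s.iter, j, p)).1
        rcases eq_on_batch hh (hsubT hg) hp2 with h1 | h1
        · rw [h1, hω]
        · rw [h1, hgx]
  · simp only [CalStops, not_or, not_le] at hdone
    -- Batch `J` meets the stopping rule, because its deviation term is at most ε/2 ≤ 2^{-l}.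
    have hjlt : j < J := by
      rcases hjJ.lt_or_eq with h | h
      · exact h
      · rw [h] at hdone
        exact absurd (hJ.trans hs.eps_le) (not_le.2 hdone.1)
    refine ⟨hs.labels_eq, hs.iter_pos, hs.k_le, hs.l_le, hs.eps_le, ?_⟩
    refine ⟨hit, hse, by omega, hjlt, ?_, ?_, hT', Set.nonempty_iff_ne_empty.2 hdone.2,
      fun _ => ⟨hdone.1.le, fun h hh h' hh' => ?_⟩⟩
    · have := pow_succ (2 : ℝ) j; push_cast; linarith
    · push_cast; linarith
    · refine hgood.difference_le h hh.1.1 h' hh'.1.1 fun p hp2 => ?_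
      rcases eq_on_batch hh (hsubT hh') hp2 with h1 | h1
      · rcases eq_on_batch hh' (hsubT hh) hp2 with h2 | h2
        · rw [h1, h2]
        · exact h2.symm
      · exact h1

/-- `B` bounds the number of label queries of a batch, either because there is nothing to
query, or because of the deviation bounds. -/
def LabelBound (H : ℕ → Set (X → Bool)) (d : ℕ → ℕ) (kstar : ℕ) (ε δ θ : ℝ) (J : ℕ)
    (B : ℝ) : Prop :=
  (disagreement (H kstar) = ∅ ∧ B = 0) ∨
    2 ≤ B ∧ ∀ k ≤ kstar, ∀ i, 1 ≤ i → i ≤ maxCalls kstar ε → ∀ j, 1 ≤ j → j + 1 ≤ J →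
      2 * (2 ^ (j + 1) * (θ * (2 * phi (d k) (2 ^ j) (batchDelta δ i j / 2))) +
        Real.log (4 / batchDelta δ i (j + 1))) ≤ B

theorem runInvariant_run (R : Realizable D H kstar hstar search ε δ)
    {ω : ℕ × ℕ × ℕ → X × Bool} (hω : GoodSample D H d search ε δ hstar ω) (hJ1 : 1 ≤ J)
    (hJ : ∀ k ≤ kstar, ∀ i, 1 ≤ i → i ≤ maxCalls kstar ε →
      phi (d k) (2 ^ J) (batchDelta δ i J / 2) ≤ ε / 2)
    (hB : LabelBound H d kstar ε δ (max 1 (maxDisagreementCoeff (D.map Prod.fst) H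
      (run H d search ε δ ω) kstar ε).toReal) J B) (t : ℕ) :
    RunInvariant D H d kstar hstar ε δ J B (run H d search ε δ ω t) := by
  classical
  induction t with
  | zero => exact RunInvariant.init R.eps_lt
  | succ t ih =>
    simp only [run]
    set s := run H d search ε δ ω t with hsdef
    cases hp : s.phase with
    | search =>
      rw [step_of_phase_search _ _ _ _ _ hp]
      exact ih.searchStep R hJ1 hp
    | halted =>
      rw [step_of_phase_halted _ _ _ _ _ hp]
      exact ih
    | cal j T =>
      rw [step_of_phase_cal _ _ _ _ _ hp]
      have hinv := ih.phase
      simp only [PhaseInvariant, hp] at hinv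
      obtain ⟨hit, hse, hj1, hjJ, hdr, hla, hT, hne, hdiam⟩ := hinv
      have hiI : s.iter ≤ maxCalls kstar ε :=
        hit.trans (Nat.add_le_add ih.k_le ih.l_le)
      have hgood := hω.2 s.iter j t ih.iter_pos hj1 ⟨rfl, T, hp⟩
      refine ih.calStep R hω.1 hp hgood (hJ s.k ih.k_le s.iter ih.iter_pos hiI) ?_
      rcases hB with ⟨hempty, rfl⟩ | ⟨h2, hB⟩
      · have hnil : queried H ω s.k s.iter j s.S T = [] := by
          refine List.filter_eq_nil_iff.2 fun p _ hdec => ?_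
          have hx := of_decide_eq_true hdec
          have hsub : versionSpace (versionSpace (H s.k) s.S) T ⊆ H kstar :=
            fun f hf => R.mono ih.k_le hf.1.1
          have := disagreement_mono hsub hx
          rw [hempty] at this
          exact this
        rw [hnil]; simp
      · by_cases hj2 : 2 ≤ j
        · obtain ⟨hphi, hdiam⟩ := hdiam hj2
          have hlen := hgood.length_le
          simp only [← hsdef, hp, phaseSamples] at hlen
          obtain ⟨j, rfl⟩ := Nat.exists_eq_add_of_le' hj1
          -- The preceding batch did not stop CAL, so φ ≥ 2^{-l} ≥ ε/2 and the diameter bound 2φ ≥ ε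
          -- is an admissible radius for the coefficient at scale ε.
          have hdis := measureReal_disagreement_le (D := D) R.meas
            (ρ := run H d search ε δ ω) (fun t t' h p hp => run_S_subset h hp) (t := t)
            (kstar := kstar) ih.k_le R.eps_pos
            (r := 2 * phi (d s.k) (2 ^ j) (batchDelta δ s.iter j / 2))
            (by have := ih.eps_le; simp only [Nat.add_sub_cancel] at hphi; linarith) hne
            (fun f hf => hf.1) (by simpa only [Nat.add_sub_cancel] using hdiam)
          have hphi0 : 0 ≤ 2 * phi (d s.k) (2 ^ j) (batchDelta δ s.iter j / 2) := by
            have := ih.eps_le; have := R.eps_pos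
            simp only [Nat.add_sub_cancel] at hphi; linarith
          refine hlen.trans (le_trans ?_
            (hB s.k ih.k_le s.iter ih.iter_pos hiI j (by omega) hjJ))
          gcongr
          exact hdis.trans (mul_le_mul_of_nonneg_right (le_max_right _ _) hphi0)
        -- The first batch has only two points, which the condition 2 ≤ `B` covers.
        · have hj : j = 1 := by omega
          subst hj
          refine le_trans ?_ h2
          exact_mod_cast length_queried_le (H := H) ω s.k s.iter 1 s.S T

/-- The progress of a run. -/
def progress (J : ℕ) (s : Config X) : ℕ :=
  match s.phase with
  | Phase.search => s.iter * (J + 1)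
  | Phase.cal j _ => s.iter * (J + 1) + j
  | Phase.halted => 0

/-- Each step that does not halt raises `progress`; since j ≤ `J`, moving on to the next iteration
also gains. An upper bound on `progress` therefore limits the running time. -/
theorem lt_progress {D : Measure (X × Bool)} {ω : ℕ × ℕ × ℕ → X × Bool}
    (hinv : ∀ t, RunInvariant D H d kstar hstar ε δ J B (run H d search ε δ ω t)) (t : ℕ)
    (hnh : (run H d search ε δ ω t).phase ≠ Phase.halted) :
    t < progress J (run H d search ε δ ω t) := by
  induction t with
  | zero => simp [run, initConfig, progress]
  | succ t ih =>
    have hi := (hinv t).phase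
    simp only [run] at hnh ⊢
    set s := run H d search ε δ ω t
    cases hp : s.phase with
    | halted => rw [step_of_phase_halted _ _ _ _ _ hp] at hnh; exact absurd hp hnh
    | search =>
      have := ih (by simp [hp])
      rw [step_of_phase_search _ _ _ _ _ hp] at hnh ⊢
      simp only [progress, hp] at this
      unfold searchStep at hnh ⊢
      split
      · split_ifs with hl
        · simp_all
        · simp only [progress]; omega
      · simp only [progress]; omega
    | cal j T =>
      have := ih (by simp [hp])
      rw [step_of_phase_cal _ _ _ _ _ hp, calStep_eq]
      simp only [progress, hp] at this
      simp only [PhaseInvariant, hp] at hi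
      split_ifs
      · simp only [progress, Nat.add_mul, one_mul]; omega
      · simp only [progress]; omega

/-- On a good sample the run halts, with a correct output and within the given resources. -/
theorem exists_halted (R : Realizable D H kstar hstar search ε δ)
    {ω : ℕ × ℕ × ℕ → X × Bool} (hω : GoodSample D H d search ε δ hstar ω) (hJ1 : 1 ≤ J)
    (hB0 : 0 ≤ B)
    (hJ : ∀ k ≤ kstar, ∀ i, 1 ≤ i → i ≤ maxCalls kstar ε →
      phi (d k) (2 ^ J) (batchDelta δ i J / 2) ≤ ε / 2)
    (hB : LabelBound H d kstar ε δ (max 1 (maxDisagreementCoeff (D.map Prod.fst) H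
      (run H d search ε δ ω) kstar ε).toReal) J B) :
    ∃ t, (run H d search ε δ ω t).phase = Phase.halted ∧
      (run H d search ε δ ω t).iter ≤ maxCalls kstar ε + 1 ∧
      (versionSpace (H (run H d search ε δ ω t).k) (run H d search ε δ ω t).S).Nonempty ∧
      (∀ h ∈ versionSpace (H (run H d search ε δ ω t).k) (run H d search ε δ ω t).S,
        err D h ≤ ε) ∧
      ((run H d search ε δ ω t).draws : ℝ) ≤ maxCalls kstar ε * 2 ^ (J + 1) ∧
      (run H d search ε δ ω t).searches ≤ maxCalls kstar ε + 1 ∧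
      ((run H d search ε δ ω t).labels : ℝ) ≤ maxCalls kstar ε * (J * B) := by
  have hinv := runInvariant_run R hω hJ1 hJ hB
  have hhalt : ∃ t, (run H d search ε δ ω t).phase = Phase.halted := by
    by_contra hno
    push Not at hno
    -- `N` bounds `progress` in every unhalted configuration allowed by the invariant.
    set N := (maxCalls kstar ε + 1) * (J + 1) + J
    have h1 := lt_progress hinv N (hno N)
    have hi := (hinv N).phase
    have hkl : (run H d search ε δ ω N).k + (run H d search ε δ ω N).l ≤ maxCalls kstar ε :=
      Nat.add_le_add (hinv N).k_le (hinv N).l_le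
    have hbound : progress J (run H d search ε δ ω N) ≤ N := by
      cases hp : (run H d search ε δ ω N).phase with
      | halted => exact absurd hp (hno N)
      | search =>
        simp only [PhaseInvariant, hp] at hi
        simp only [progress, hp]
        have : (run H d search ε δ ω N).iter ≤ maxCalls kstar ε + 1 := by omega
        exact (Nat.mul_le_mul_right _ this).trans (Nat.le_add_right _ _)
      | cal j T =>
        simp only [PhaseInvariant, hp] at hi
        simp only [progress, hp]
        have : (run H d search ε δ ω N).iter ≤ maxCalls kstar ε + 1 := by omega
        exact Nat.add_le_add (Nat.mul_le_mul_right _ this) hi.2.2.2.1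
    omega
  obtain ⟨t, ht⟩ := hhalt
  have hi := (hinv t).phase
  have hkl : (run H d search ε δ ω t).k + (run H d search ε δ ω t).l ≤ maxCalls kstar ε :=
    Nat.add_le_add (hinv t).k_le (hinv t).l_le
  simp only [PhaseInvariant, ht] at hi
  obtain ⟨hit, hse, hdr, hla, hne, herr⟩ := hi
  have hit' : (run H d search ε δ ω t).iter ≤ maxCalls kstar ε + 1 := by omega
  have hitR : ((run H d search ε δ ω t).iter : ℝ) - 1 ≤ maxCalls kstar ε := by
    have : ((run H d search ε δ ω t).iter : ℝ) ≤ maxCalls kstar ε + 1 := by exact_mod_cast hit'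
    linarith
  refine ⟨t, ht, hit', hne, herr, hdr.trans ?_, by omega, hla.trans ?_⟩
  · exact mul_le_mul_of_nonneg_right hitR (by positivity)
  · exact mul_le_mul_of_nonneg_right hitR (by positivity)

end Invariant

/-! ### Numerical bounds on batches, draws and labels. -/

section Resources

theorem two_pow_mul_phi_le {d₀ d i j I J : ℕ} {δ : ℝ} (hδ : 0 < δ) (hd : d₀ ≤ d) (hi : 1 ≤ i)
    (hiI : i ≤ I) (hj : 1 ≤ j) (hjJ : j ≤ J) :
    Real.log (4 / batchDelta δ i j) ≤ Real.log (4 * (I * (I + 1)) / δ) + 2 * J ∧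
    2 ^ j * phi d₀ (2 ^ j) (batchDelta δ i j / 2) ≤
      d * (1 + 2 * J) + (Real.log (4 * (I * (I + 1)) / δ) + 2 * J) := by
  have hi' : (1 : ℝ) ≤ i := by exact_mod_cast hi
  have hj' : (1 : ℝ) ≤ j := by exact_mod_cast hj
  have hiI' : (i : ℝ) ≤ I := by exact_mod_cast hiI
  have hjJ' : (j : ℝ) ≤ J := by exact_mod_cast hjJ
  have hd' : (d₀ : ℝ) ≤ d := by exact_mod_cast hd
  have hlog : Real.log (4 / batchDelta δ i j) ≤
      Real.log (4 * (I * (I + 1)) / δ) + 2 * J := by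
    have h1 : 4 / batchDelta δ i j = 4 * (i * (i + 1)) / δ * (j * (j + 1)) := by
      unfold batchDelta; field_simp
    rw [h1, Real.log_mul (by positivity) (by positivity),
      Real.log_mul (x := (j : ℝ)) (by positivity) (by positivity)]
    have h2 := Real.log_le_sub_one_of_pos (by positivity : (0 : ℝ) < j)
    have h3 := Real.log_le_sub_one_of_pos (by positivity : (0 : ℝ) < j + 1)
    have h4 : Real.log (4 * (i * (i + 1)) / δ) ≤ Real.log (4 * (I * (I + 1)) / δ) := by
      apply Real.log_le_log (by positivity)
      gcongr
    linarith
  refine ⟨hlog, ?_⟩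
  have h5 := natCast_mul_phi (d := d₀) (m := 2 ^ j) (by positivity) (batchDelta δ i j / 2)
  rw [log_exp_mul_sq (by positivity)] at h5
  push_cast at h5
  rw [h5, Real.log_pow]
  have h6 : 2 / (batchDelta δ i j / 2) = 4 / batchDelta δ i j := by
    rw [div_div_eq_mul_div]; norm_num
  rw [h6]
  have h7 : (j : ℝ) * Real.log 2 ≤ J := by
    have := Real.log_two_lt_d9
    have := Real.log_two_gt_d9
    nlinarith
  have h8 : (d₀ : ℝ) * (1 + 2 * (j * Real.log 2)) ≤ d * (1 + 2 * J) := by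
    have : 0 ≤ (j : ℝ) * Real.log 2 := mul_nonneg (by linarith) (Real.log_nonneg (by norm_num))
    gcongr
  linarith

/-- The constant 48 arises from I ≤ 3m, which gives 4·I(I+1) ≤ 4·3m·4m for m ≥ 1. -/
theorem log_le_two_mul_of_le_sq {x y : ℝ} (hx : 0 < x) (hy : 1 ≤ y) (h : x ≤ 48 * y ^ 2) :
    Real.log x ≤ 4 * (1 + Real.log y) := by
  have hy0 : 0 < y := by linarith
  have h48 : Real.log 48 ≤ 4 := by
    rw [Real.log_le_iff_le_exp (by norm_num)]
    have h1 := Real.exp_one_gt_d9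
    have h2 : Real.exp 4 = Real.exp 1 ^ 4 := by rw [← Real.exp_nat_mul]; norm_num
    rw [h2]
    have h3 : (2.7 : ℝ) ^ 4 ≤ Real.exp 1 ^ 4 := pow_le_pow_left₀ (by norm_num) (by linarith) 4
    norm_num at h3 ⊢
    linarith
  have h1 := Real.log_le_log hx h
  rw [Real.log_mul (by norm_num) (by positivity), Real.log_pow] at h1
  have := Real.log_nonneg hy
  push_cast at h1
  linarith

theorem maxCalls_le {kstar : ℕ} {ε : ℝ} (hε : 0 < ε) (hε1 : ε < 1) :
    (maxCalls kstar ε : ℝ) ≤ kstar + 2 * Real.log (1 / ε) + 1 := by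
  have hl : 0 ≤ Real.log (1 / ε) := Real.log_nonneg (by rw [le_div_iff₀ hε]; linarith)
  have h2 := Real.log_two_gt_d9
  have h1 : Real.logb 2 (1 / ε) ≤ 2 * Real.log (1 / ε) := by
    rw [Real.logb, div_le_iff₀ (by linarith)]
    nlinarith
  have h0 : 0 ≤ Real.logb 2 (1 / ε) := by
    rw [Real.logb]; exact div_nonneg hl (by linarith)
  have := Nat.ceil_lt_add_one h0
  unfold maxCalls
  push_cast
  linarith

theorem one_le_maxCalls {kstar : ℕ} {ε : ℝ} (hε : 0 < ε) (hε1 : ε < 1) :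
    1 ≤ maxCalls kstar ε := by
  have h0 : 0 < Real.logb 2 (1 / ε) :=
    Real.logb_pos (by norm_num) (by rw [lt_div_iff₀ hε]; linarith)
  have := Nat.ceil_pos.2 h0
  unfold maxCalls
  omega

/-- A number of batches after which CAL always stops, and the resulting totals: `I` is the number
of calls, `J` the number of batches in a call and `Q` the confidence term. -/
theorem exists_batch_bound {kstar d : ℕ} {ε δ : ℝ} (hε : 0 < ε) (hε1 : ε < 1) (hδ : 0 < δ)
    (hδ1 : δ < 1) :
    let I := maxCalls kstar ε
    let K := max 1 (kstar : ℝ)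
    let D := max 1 (d : ℝ)
    let L := max 1 (Real.log (1 / ε))
    let Q := Real.log (4 * (I * (I + 1)) / δ)
    let Λ := 1 + Real.log ((kstar + L) * D / δ)
    let W := 1 + Real.log (K * D / (ε * δ))
    ∃ J : ℕ, 1 ≤ J ∧ d * (1 + 2 * J) + (Q + 2 * J) ≤ 2 ^ J * (ε / 2) ∧
      I * 2 ^ (J + 1) ≤ 3072 * (K * D / ε) * W ^ 2 ∧
      (J : ℝ) ≤ 13 * (L * Λ) ∧ 0 ≤ Q ∧ Q ≤ 4 * Λ ∧ 1 ≤ L ∧ 1 ≤ Λ ∧ (I : ℝ) ≤ 3 * (kstar + L) := by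
  intro I K D L Q Λ W
  have hK : 1 ≤ K := le_max_left _ _
  have hkK : (kstar : ℝ) ≤ K := le_max_right _ _
  have hD : 1 ≤ D := le_max_left _ _
  have hdD : (d : ℝ) ≤ D := le_max_right _ _
  have hL : 1 ≤ L := le_max_left _ _
  have hlL : Real.log (1 / ε) ≤ L := le_max_right _ _
  have hk0 : (0 : ℝ) ≤ kstar := Nat.cast_nonneg _
  have hIle : (I : ℝ) ≤ kstar + 2 * Real.log (1 / ε) + 1 := maxCalls_le hε hε1
  have hI1 : (1 : ℝ) ≤ I := by exact_mod_cast one_le_maxCalls (kstar := kstar) hε hε1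
  have hE : 1 ≤ 1 / ε := by rw [le_div_iff₀ hε]; linarith
  have hlogE : Real.log (1 / ε) ≤ 1 / ε - 1 := Real.log_le_sub_one_of_pos (by positivity)
  have hlogE0 : 0 ≤ Real.log (1 / ε) := Real.log_nonneg hE
  have hinvδ : 1 ≤ 1 / δ := by rw [le_div_iff₀ hδ]; linarith
  set E := 1 / ε with hEdef
  set Δ := 1 / δ with hΔdef
  have hM : 1 ≤ kstar + L := by linarith
  have hIM : (I : ℝ) ≤ 3 * (kstar + L) := by linarith
  have hDΔ : 1 ≤ D * Δ := one_le_mul_of_one_le_of_one_le hD hinvδ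
  have hyΛ : 1 ≤ (kstar + L) * D / δ := by
    have : (kstar + L) * D / δ = (kstar + L) * (D * Δ) := by rw [hΔdef]; ring
    rw [this]; exact one_le_mul_of_one_le_of_one_le hM hDΔ
  have hΛ : 1 ≤ Λ := by have := Real.log_nonneg hyΛ; linarith
  have hQ0 : 0 ≤ Q := by
    apply Real.log_nonneg
    rw [le_div_iff₀ hδ]
    nlinarith
  have hQpos : 0 < 4 * ((I : ℝ) * (I + 1)) / δ := by positivity
  have hQeq : 4 * ((I : ℝ) * (I + 1)) / δ = 4 * ((I : ℝ) * (I + 1)) * Δ := by rw [hΔdef]; ring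
  have hquad : ∀ m : ℝ, 1 ≤ m → (I : ℝ) ≤ 3 * m →
      4 * ((I : ℝ) * (I + 1)) / δ ≤ 48 * (m * (D * Δ)) ^ 2 := by
    intro m hm hIm
    rw [hQeq]
    have h1 : (I : ℝ) * (I + 1) ≤ 3 * m * (4 * m) := by
      apply mul_le_mul hIm (by linarith) (by positivity) (by positivity)
    have h2 : Δ ≤ (D * Δ) ^ 2 :=
      (le_mul_of_one_le_left (by positivity) hD).trans (le_self_pow₀ hDΔ (by norm_num))
    calc 4 * ((I : ℝ) * (I + 1)) * Δ ≤ 4 * (3 * m * (4 * m)) * (D * Δ) ^ 2 := by gcongr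
      _ = _ := by ring
  have hQΛ : Q ≤ 4 * Λ := by
    refine log_le_two_mul_of_le_sq hQpos hyΛ ?_
    have : (kstar + L) * D / δ = (kstar + L) * (D * Δ) := by rw [hΔdef]; ring
    rw [this]
    exact hquad _ hM hIM
  have hKE : 1 ≤ K * E := one_le_mul_of_one_le_of_one_le hK hE
  have hyWeq : K * D / (ε * δ) = K * E * (D * Δ) := by
    rw [hEdef, hΔdef]; field_simp
  have hyW : 1 ≤ K * D / (ε * δ) := by rw [hyWeq]; exact one_le_mul_of_one_le_of_one_le hKE hDΔ
  have hW : 1 ≤ W := by have := Real.log_nonneg hyW; linarith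
  have hIKE : (I : ℝ) ≤ 3 * (K * E) := by
    have h1 : K ≤ K * E := le_mul_of_one_le_right (by positivity) hE
    have h2 : E ≤ K * E := le_mul_of_one_le_left (by positivity) hK
    linarith
  have hQW : Q ≤ 4 * W := by
    refine log_le_two_mul_of_le_sq hQpos hyW ?_
    rw [hyWeq]
    exact hquad _ hKE hIKE
  have hlogEW : Real.log E ≤ W - 1 := by
    simp only [W, add_sub_cancel_left]
    apply Real.log_le_log (by positivity)
    rw [hyWeq]
    exact (le_mul_of_one_le_left (by positivity) hK).trans
      (le_mul_of_one_le_right (by positivity) hDΔ)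
  have hlogDE : Real.log (D * E) ≤ W - 1 := by
    simp only [W, add_sub_cancel_left]
    apply Real.log_le_log (by positivity)
    rw [hyWeq]
    have h1 : D ≤ D * Δ := le_mul_of_one_le_right (by positivity) hinvδ
    have h2 : E ≤ K * E := le_mul_of_one_le_left (by positivity) hK
    calc D * E ≤ (D * Δ) * (K * E) := mul_le_mul h1 h2 (by positivity) (by positivity)
      _ = _ := by ring
  have hWL : W ≤ 2 * (L * Λ) := by
    have h1 : W ≤ L + Λ := by
      simp only [W, Λ]
      rw [hyWeq]
      have h2 : (kstar + L) * D / δ = (kstar + L) * (D * Δ) := by rw [hΔdef]; ring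
      have h3 : K ≤ kstar + L := max_le hM (by linarith)
      rw [h2, mul_right_comm, Real.log_mul (by positivity) (by positivity)]
      have h4 : Real.log (K * (D * Δ)) ≤ Real.log ((kstar + L) * (D * Δ)) := by
        apply Real.log_le_log (by positivity)
        gcongr
      linarith
    have h1L : L ≤ L * Λ := le_mul_of_one_le_right (by positivity) hΛ
    have h1Λ : Λ ≤ L * Λ := le_mul_of_one_le_left (by positivity) hL
    linarith
  -- A call needs about D(21 + 20W) ≤ 128·D·W = 2^8·Y·(ε/2) to be at most 2^J·(ε/2), so J = 8 +
  -- ⌈log₂ Y⌉ suffices. Rounding up costs at most a factor 2 in the number of draws.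
  set Y := D * E * W with hY
  have hDE : 1 ≤ D * E := one_le_mul_of_one_le_of_one_le hD hE
  have hY1 : 1 ≤ Y := one_le_mul_of_one_le_of_one_le hDE hW
  have hY0 : 0 < Y := by linarith
  set n := ⌈Real.logb 2 Y⌉₊ with hn
  have hlogY : Real.log Y ≤ 2 * W - 2 := by
    rw [hY, Real.log_mul (by positivity) (by positivity)]
    have := Real.log_le_sub_one_of_pos (by linarith : 0 < W)
    linarith
  have hlogY0 : 0 ≤ Real.log Y := Real.log_nonneg hY1
  have hlb0 : 0 ≤ Real.logb 2 Y := Real.logb_nonneg (by norm_num) hY1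
  have hnlt : (n : ℝ) < Real.logb 2 Y + 1 := Nat.ceil_lt_add_one hlb0
  have hYn : Y ≤ 2 ^ n := by
    have := (Real.logb_le_iff_le_rpow (b := 2) (by norm_num) hY0).1 (Nat.le_ceil (Real.logb 2 Y))
    rwa [Real.rpow_natCast] at this
  have hnY : (2 : ℝ) ^ n ≤ 2 * Y := by
    have h1 : (2 : ℝ) ^ (n : ℝ) ≤ 2 ^ (Real.logb 2 Y + 1) :=
      Real.rpow_le_rpow_of_exponent_le (by norm_num) hnlt.le
    rw [Real.rpow_natCast, Real.rpow_add (by norm_num), Real.rpow_logb (by norm_num) (by norm_num)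
      hY0, Real.rpow_one] at h1
    linarith
  have hn4 : (n : ℝ) ≤ 4 * W - 3 := by
    have h2 := Real.log_two_gt_d9
    have : Real.logb 2 Y ≤ 2 * Real.log Y := by
      rw [Real.logb, div_le_iff₀ (by linarith)]
      nlinarith
    linarith
  refine ⟨8 + n, by omega, ?_, ?_, ?_, hQ0, hQΛ, hL, hΛ, hIM⟩
  · push_cast
    rw [pow_add]
    have h1 : (d : ℝ) * (1 + 2 * (8 + n)) ≤ D * (1 + 2 * (8 + n)) := by gcongr
    have h2 : Q + 2 * (8 + (n : ℝ)) ≤ D * (Q + 2 * (8 + n)) := by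
      exact le_mul_of_one_le_left (by positivity) hD
    have h3 : D * (1 + 2 * (8 + n)) + D * (Q + 2 * (8 + (n : ℝ))) ≤ D * (128 * W) := by
      rw [← mul_add]
      apply mul_le_mul_of_nonneg_left _ (by linarith)
      linarith
    have h4 : D * (128 * W) = 2 ^ 8 * Y * (ε / 2) := by
      rw [hY, hEdef]; field_simp; norm_num
    have h5 : (2 : ℝ) ^ 8 * Y * (ε / 2) ≤ 2 ^ 8 * 2 ^ n * (ε / 2) := by gcongr
    linarith
  · have h1 : (I : ℝ) ≤ 3 * (K * W) := by
      have : K + 2 * W - 1 ≤ 3 * (K * W) := by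
        have h1 : K ≤ K * W := le_mul_of_one_le_right (by positivity) hW
        have h2 : W ≤ K * W := le_mul_of_one_le_left (by positivity) hK
        linarith
      linarith
    have h2 : (2 : ℝ) ^ (8 + n + 1) ≤ 1024 * Y := by
      rw [pow_add, pow_add]; norm_num; linarith
    calc (I : ℝ) * 2 ^ (8 + n + 1) ≤ 3 * (K * W) * (1024 * Y) :=
          mul_le_mul h1 h2 (by positivity) (by positivity)
      _ = _ := by rw [hY, hEdef]; ring
  · push_cast
    have : 1 ≤ L * Λ := one_le_mul_of_one_le_of_one_le hL hΛ
    linarith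

/-- A point of disagreement is a shattered singleton. This handles the factor d in the label bound
when d = 0: nothing is ever queried. -/
theorem disagreement_eq_empty {X : Type*} {V : Set (X → Bool)} (hV : vcDim V = 0) :
    disagreement V = ∅ := by
  rw [Set.eq_empty_iff_forall_notMem]
  rintro x ⟨h, hh, h', hh', hne⟩
  have hsh : Shatters V {x} := by
    intro f
    by_cases hf : h x = f x
    · exact ⟨h, hh, by simpa using hf⟩
    · refine ⟨h', hh', ?_⟩
      simp only [Finset.mem_singleton, forall_eq]
      revert hne hf
      cases h x <;> cases h' x <;> cases f x <;> simp
  have h1 : ((({x} : Finset X).card : ℕ) : ℕ∞) ≤ vcDim V :=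
    le_iSup₂ (f := fun (s : Finset X) (_ : Shatters V s) => (s.card : ℕ∞)) _ hsh
  rw [hV] at h1
  simp at h1

/-- For d ≥ 1 and θ ≥ 1, the sum 8θ(d(1 + 2J) + Q + 2J) + 2(Q + 2J) is at most θd(8 + 36J + 10Q),
where Q is the confidence logarithm. -/
theorem labelBound_of_batch_bound {X : Type*} {H : ℕ → Set (X → Bool)} {d : ℕ → ℕ} {kstar : ℕ}
    (hmono : Monotone H) (hd : ∀ k, vcDim (H k) = d k) {ε δ θ : ℝ} (hδ : 0 < δ) (hθ : 1 ≤ θ)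
    {J : ℕ} (hQ : 0 ≤ Real.log (4 * (maxCalls kstar ε * (maxCalls kstar ε + 1)) / δ)) :
    LabelBound H d kstar ε δ θ J (θ * d kstar *
      (8 + 36 * J + 10 * Real.log (4 * (maxCalls kstar ε * (maxCalls kstar ε + 1)) / δ))) := by
  set Q := Real.log (4 * (maxCalls kstar ε * (maxCalls kstar ε + 1)) / δ)
  rcases Nat.eq_zero_or_pos (d kstar) with h0 | hpos
  · left
    refine ⟨disagreement_eq_empty (by rw [hd, h0]; rfl), by rw [h0]; simp⟩
  · right
    have hd1 : (1 : ℝ) ≤ d kstar := by exact_mod_cast hpos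
    have hθd : 1 ≤ θ * d kstar := by nlinarith
    have hJ0 : (0 : ℝ) ≤ J := Nat.cast_nonneg _
    refine ⟨by nlinarith, fun k hk i hi hiI j hj hjJ => ?_⟩
    have hdk : d k ≤ d kstar := by
      have := vcDim_mono (hmono hk)
      rw [hd, hd] at this
      exact_mod_cast this
    have h1 := (two_pow_mul_phi_le hδ hdk hi hiI hj (by omega : j ≤ J)).2
    have h2 := (two_pow_mul_phi_le hδ hdk hi hiI (by omega : 1 ≤ j + 1) hjJ).1
    set F := phi (d k) (2 ^ j) (batchDelta δ i j / 2)
    have h3 : 2 * (2 ^ (j + 1) * (θ * (2 * F)) + Real.log (4 / batchDelta δ i (j + 1))) =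
        8 * θ * (2 ^ j * F) + 2 * Real.log (4 / batchDelta δ i (j + 1)) := by
      rw [pow_succ]; ring
    rw [h3]
    have h4 : 8 * θ * (2 ^ j * F) ≤ 8 * θ * (d kstar * (1 + 2 * J) + (Q + 2 * J)) :=
      mul_le_mul_of_nonneg_left h1 (by linarith)
    have h5 : 0 ≤ Q + 2 * (J : ℝ) := by linarith
    have h6 : θ * (Q + 2 * J) ≤ θ * d kstar * (Q + 2 * J) :=
      mul_le_mul_of_nonneg_right (by nlinarith) h5
    have h7 : Q + 2 * J ≤ θ * d kstar * (Q + 2 * J) := by nlinarith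
    nlinarith

end Resources

end ActiveLearning

/-! ### The main theorem. -/

theorem theorem1 :
    ∃ (C : ℝ) (c : ℕ), ∀ (X : Type*) [MeasurableSpace X]
      (D : Measure (X × Bool)) [IsProbabilityMeasure D]
      (H : ℕ → Set (X → Bool)) (d : ℕ → ℕ) (kstar : ℕ) (hstar : X → Bool)
      (search : ℕ → List (X × Bool) → Option (X × Bool)) (ε δ : ℝ),
      Monotone H →
      (∀ k, vcDim (H k) = d k) →
      (∀ k, ∀ h ∈ H k, Measurable h) →
      (∀ k, PointwiseSeparable (H k)) →
      IsOptimal D H kstar hstar →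
      err D hstar = 0 →
      IsSearchOracle H hstar search →
      MeasurableOracle search →
      0 < ε → ε < 1 → 0 < δ → δ < 1 →
      (Measure.infinitePi fun _ : ℕ × ℕ × ℕ => D)
        {ω | ¬ ∃ t,
          let ρ := run H d search ε δ ω
          let s := ρ t
          let L := max 1 (Real.log (1 / ε))
          let θ := (maxDisagreementCoeff (D.map Prod.fst) H ρ kstar ε).toReal
          s.phase = Phase.halted ∧
          s.iter ≤ kstar + ⌈Real.logb 2 (1 / ε)⌉₊ + 1 ∧
          (versionSpace (H s.k) s.S).Nonempty ∧
          (∀ h ∈ versionSpace (H s.k) s.S, err D h ≤ ε) ∧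
          (s.draws : ℝ) ≤ C * (max 1 (kstar : ℝ) * max 1 (d kstar : ℝ) / ε) *
            (1 + Real.log (max 1 (kstar : ℝ) * max 1 (d kstar : ℝ) / (ε * δ))) ^ c ∧
          s.searches ≤ kstar + ⌈Real.logb 2 (1 / ε)⌉₊ + 1 ∧
          (s.labels : ℝ) ≤ C * ((kstar + L) * max 1 θ * d kstar * L ^ 2) *
            (1 + Real.log ((kstar + L) * max 1 (d kstar : ℝ) / δ)) ^ c}
        ≤ ENNReal.ofReal δ := by
  -- 20124 = 3·13·516, from I ≤ 3(k* + L), J ≤ 13LΛ and 8 + 36J + 10Q ≤ 516LΛ; the draws need only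
  -- 3072. The two factors LΛ give L² and the exponent 2.
  refine ⟨20124, 2, ?_⟩
  intro X _ D _ H d kstar hstar search ε δ hmono hd hmeas hsep hopt herr horacle hsm hε hε1 hδ hδ1
  have R : Realizable D H kstar hstar search ε δ :=
    ⟨hmono, hmeas, hsep, hopt.1, herr, horacle, hε, hε1, hδ, hδ1⟩
  refine le_trans (measure_mono ?_) (infinitePi_not_goodSample_le (ε := ε) hsep hmeas hd
    (hmeas kstar hstar hopt.1) herr hsm hδ hδ1)
  refine fun ω hω hgood => hω ?_
  obtain ⟨J, hJ1, hJ, hdraws, hJL, hQ0, hQΛ, hL, hΛ, hIM⟩ :=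
    exists_batch_bound (kstar := kstar) (d := d kstar) hε hε1 hδ hδ1
  set θ := max 1 (maxDisagreementCoeff (D.map Prod.fst) H (run H d search ε δ ω) kstar ε).toReal
    with hθdef
  have hθ : 1 ≤ θ := le_max_left _ _
  set Q := Real.log (4 * (maxCalls kstar ε * (maxCalls kstar ε + 1)) / δ)
  set L := max 1 (Real.log (1 / ε))
  set Λ := 1 + Real.log ((kstar + L) * max 1 (d kstar : ℝ) / δ)
  set B := θ * d kstar * (8 + 36 * J + 10 * Q)
  have hB0 : 0 ≤ B := by positivity
  have hdone : ∀ k ≤ kstar, ∀ i, 1 ≤ i → i ≤ maxCalls kstar ε →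
      phi (d k) (2 ^ J) (batchDelta δ i J / 2) ≤ ε / 2 := by
    intro k hk i hi hiI
    have hdk : d k ≤ d kstar := by
      have := ActiveLearning.vcDim_mono (hmono hk)
      rw [hd, hd] at this
      exact_mod_cast this
    have h1 := (two_pow_mul_phi_le hδ hdk hi hiI hJ1 le_rfl).2
    exact le_of_mul_le_mul_left (h1.trans hJ) (by positivity)
  obtain ⟨t, hhalt, hiter, hne, herr', hdr, hse, hla⟩ := exists_halted R hgood hJ1 hB0 hdone
    (labelBound_of_batch_bound hmono hd hδ hθ hQ0)
  refine ⟨t, hhalt, hiter, hne, herr', ?_, hse, ?_⟩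
  · refine (hdr.trans hdraws).trans ?_
    have : (0 : ℝ) ≤ max 1 (kstar : ℝ) * max 1 (d kstar : ℝ) / ε := by positivity
    gcongr
    norm_num
  · refine hla.trans ?_
    have hLΛ : 1 ≤ L * Λ := by nlinarith
    have hΛL : Λ ≤ L * Λ := by nlinarith
    have hsum : 8 + 36 * (J : ℝ) + 10 * Q ≤ 516 * (L * Λ) := by linarith
    have hk0 : (0 : ℝ) ≤ kstar + L := by positivity
    calc (maxCalls kstar ε : ℝ) * (J * B) ≤
          3 * (kstar + L) * (13 * (L * Λ) * (θ * d kstar * (516 * (L * Λ)))) := by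
          simp only [B]
          gcongr
      _ = 20124 * ((kstar + L) * θ * d kstar * L ^ 2) * Λ ^ 2 := by ring
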